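/- Let $\Psi$ be a finite non-empty set of $G=|\Psi|$ user groups, with $Q\ge 1$ served users $(\psi,k)$, $k\in[Q]$, in each group $\psi\in\Psi$. User $(\psi,k)$ has $M_{\psi,k}\ge 1$ receive antennas; put $M_\psi=\sum_{k}M_{\psi,k}$. Let $N_0,P_{\rm tot},\beta_{\psi,k}>0$, and let $\xi=\xi_{G,Q}=1-\Theta\big(\sum_{\psi,k}M_{\psi,k}\big)/T>0$, where $T>0$ is the length of the coherence block and $\Theta\ge 0$ the number of pilot symbols per receive antenna and block. For each number $L$ of transmit antennas let ${\bf H}_{\psi,k}\in\mathbb C^{L\times M_{\psi,k}}$ be random matrices (independent Rayleigh fading) with jointly independent entries, those of ${\bf H}_{\psi,k}$ having the circularly symmetric complex Gaussian law $\mathcal{CN}(0,\beta_{\psi,k})$; all of them live on one probability space, with arbitrary dependence between different $L$. All parameters except $L$ are fixed. Let ${\bf H}_{\psi,-k}$ consist of the columns of all ${\bf H}_{\psi,j}$ with $j\ne k$, and let ${\bf T}_{\psi,-k}={\bf I}_L-{\bf H}_{\psi,-k}^*({\bf H}_{\psi,-k}^T{\bf H}_{\psi,-k}^*)^{-1}{\bf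 H}_{\psi,-k}^T$, where ${}^*$ is the entrywise complex conjugate. In the BD-MRC scheme with $M_{\psi,k}$ streams per user, stream $q$ of user $(\psi,k)$ uses the precoder ${\bf v}_{\psi,k,q}={\bf T}_{\psi,-k}{\bf m}_{\psi,k,q}/\|{\bf T}_{\psi,-k}{\bf m}_{\psi,k,q}\|$, where ${\bf m}_{\psi,k,1},\dots,{\bf m}_{\psi,k,M_{\psi,k}}$ are orthogonal eigenvectors of ${\bf T}_{\psi,-k}{\bf H}_{\psi,k}^*{\bf H}_{\psi,k}^T{\bf T}_{\psi,-k}$ for nonzero eigenvalues, and the combiner ${\bf r}_{\psi,k,q}={\bf H}_{\psi,k}^T{\bf v}_{\psi,k,q}/\|{\bf H}_{\psi,k}^T{\bf v}_{\psi,k,q}\|$. For powers $P_{\psi,k,q}\ge 0$ its SINR is $P_{\psi,k,q}|{\bf r}_{\psi,k,q}^H{\bf H}_{\psi,k}^T{\bf v}_{\psi,k,q}|^2$ divided by $N_0+\sum_{(j,p)\neq(k,q)}P_{\psi,j,p}|{\bf r}_{\psi,k,q}^H{\bf H}_{\psi,k}^T{\bf v}_{\psi,j,p}|^2$, and the rate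 of user $(\psi,k)$ is $R_{\psi,k}=\xi\sum_q\ln(1+{\rm SINR}_{\psi,k,q})$. A power allocation is MMF-optimal if it maximizes $\min_{\psi,k}R_{\psi,k}$ among all allocations with $P_{\psi,k,q}\ge0$ and $\sum_{\psi,k,q}P_{\psi,k,q}\le P_{\rm tot}$; $R^\star=\sum_{\psi,k}R_{\psi,k}$ denotes the sum-rate at such an optimum. For every $L$ with $L>M_\psi-M_{\psi,k}$ for all $\psi,k$, the equation $$\sum_{\psi\in\Psi}\sum_{k\in[Q]}\frac{N_0M_{\psi,k}\Big(\exp\big(\tfrac{\mathring R}{\xi M_{\psi,k}GQ}\big)-1\Big)}{\beta_{\psi,k}(L-M_\psi+M_{\psi,k})}=P_{\rm tot}$$ has exactly one real solution $\mathring R=\mathring R_L$; put $$\mathring P_{\psi,k,q}=\frac{N_0\Big(\exp\big(\tfrac{\mathring R}{\xi M_{\psi,k}GQ}\big)-1\Big)}{\beta_{\psi,k}(L-M_\psi+M_{\psi,k})}\qquad(q\in[M_{\psi,k}]).$$ Then almost surely, as $L\to\infty$ (with $\simeq$ meaning that the ratio tends to $1$): 1. Every eigenvalue $\lambda_{\psi,k,q}$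 of ${\bf H}_{\psi,k}^T{\bf T}_{\psi,-k}{\bf H}_{\psi,k}^*$ satisfies $\lambda_{\psi,k,q}\simeq\beta_{\psi,k}(L-M_\psi+M_{\psi,k})$. For all large $L$ these matrices have full rank $M_{\psi,k}$, and a BD-MRC scheme as above and, for each such scheme, an MMF-optimal allocation exist. 2. For every choice of BD-MRC schemes and of MMF-optimal allocations, $R^\star-\mathring R\to0$ and $R^\star\simeq\mathring R$. 3. For all large $L$ the equal-per-stream allocation $\mathring P$ is feasible with total power exactly $P_{\rm tot}$. It is asymptotically optimal: under it $R_{\psi,k}-\mathring R/(GQ)\to0$ for each user, and the difference between the optimal minimum rate and its minimum rate tends to $0$. Moreover, each MMF-optimal allocation satisfies $P_{\psi,k,q}\simeq\mathring P_{\psi,k,q}$ for all $\psi,k,q$. 4. If $M_{\psi,k}=M$ for all $\psi,k$, then $\mathring R=\xi GQM\ln\Big(1+\frac{P_{\rm tot}(L-(Q-1)M)}{N_0M\sum_{\psi,k}\beta_{\psi,k}^{-1}}\Big)$; hence $R^\star$ is $\simeq$ this expression, and the difference of the two tends to $0$. -/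

import Mathlib

open MeasureTheory ProbabilityTheory Filter Topology Matrix
open scoped NNReal

noncomputable section

namespace VCC

/-- The circularly symmetric complex Gaussian law `CN(0, v)`: independent real and imaginary
parts, each of law `N(0, v / 2)`. -/
def complexGaussian (v : ℝ) : Measure ℂ :=
  ((gaussianReal 0 (v / 2).toNNReal).prod (gaussianReal 0 (v / 2).toNNReal)).map
    Complex.measurableEquivRealProd.symm

section Model

variable {Ψ : Type*} {Q : ℕ} {M : Ψ → Fin Q → ℕ}

/-- One channel realization with `L` transmit antennas: for every user `(ψ, k)` the
`L × M ψ k` channel matrix. -/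
abbrev Channel (L : ℕ) (M : Ψ → Fin Q → ℕ) : Type _ :=
  ∀ (ψ : Ψ) (k : Fin Q), Matrix (Fin L) (Fin (M ψ k)) ℂ

/-- A power allocation: one real number per user and stream. -/
abbrev Powers (M : Ψ → Fin Q → ℕ) : Type _ :=
  ∀ (ψ : Ψ) (k : Fin Q), Fin (M ψ k) → ℝ

/-- For every user `(ψ, k)` and every stream of this user a vector in `ℂ ^ L`. -/
abbrev Directions (L : ℕ) (M : Ψ → Fin Q → ℕ) : Type _ :=
  ∀ (ψ : Ψ) (k : Fin Q), Fin (M ψ k) → Fin L → ℂ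

/-- Independent Rayleigh fading: all entries of all channel matrices are jointly independent, and
those of user `(ψ, k)` have law `CN(0, β ψ k)`. -/
structure IsRayleigh {Ω : Type*} [MeasurableSpace Ω] (μ : Measure Ω) {L : ℕ}
    (β : Ψ → Fin Q → ℝ) (H : Ω → Channel L M) : Prop where
  law : ∀ (ψ : Ψ) (k : Fin Q) (i : Fin L) (j : Fin (M ψ k)),
    HasLaw (fun ω => H ω ψ k i j) (complexGaussian (β ψ k)) μ
  indep : iIndepFun
    (fun (e : Σ u : Ψ × Fin Q, Fin L × Fin (M u.1 u.2)) (ω : Ω) =>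
      H ω e.1.1 e.1.2 e.2.1 e.2.2) μ

/-- The total number of receive antennas of the served users of group `ψ`. -/
def groupAntennas (M : Ψ → Fin Q → ℕ) (ψ : Ψ) : ℕ := ∑ k, M ψ k

/-- The fraction `1 - Θ (∑ M) / T` of a coherence block of `T` symbols that is left after pilot
transmission with `Θ` symbols per receive antenna. -/
def csiFactor [Fintype Ψ] (M : Ψ → Fin Q → ℕ) (Θ T : ℝ) : ℝ :=
  1 - Θ * (∑ ψ, ∑ k, (M ψ k : ℝ)) / T

/-- The number `G Q` of simultaneously served users. -/
def numUsers (Ψ : Type*) [Fintype Ψ] (Q : ℕ) : ℝ := (Fintype.card Ψ : ℝ) * (Q : ℝ)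

variable {L : ℕ}

/-- The matrix whose columns are the columns of the channels of all users of group `ψ` other
than `k`. -/
def others (h : Channel L M) (ψ : Ψ) (k : Fin Q) :
    Matrix (Fin L) (Σ j : {j : Fin Q // j ≠ k}, Fin (M ψ j)) ℂ :=
  fun i x => h ψ x.1 i x.2

/-- The block-diagonalization projection `I - A* (Aᵀ A*)⁻¹ Aᵀ`, where `A` collects the channels of
the other users of the group and `A* = Aᵀᴴ` is the entrywise conjugate. -/
def proj (h : Channel L M) (ψ : Ψ) (k : Fin Q) : Matrix (Fin L) (Fin L) ℂ :=
  1 - (others h ψ k)ᵀᴴ * ((others h ψ k)ᵀ * (others h ψ k)ᵀᴴ)⁻¹ * (others h ψ k)ᵀ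

/-- The effective `M ψ k × M ψ k` matrix `Hᵀ T H*`. -/
def effGram (h : Channel L M) (ψ : Ψ) (k : Fin Q) : Matrix (Fin (M ψ k)) (Fin (M ψ k)) ℂ :=
  (h ψ k)ᵀ * proj h ψ k * (h ψ k)ᵀᴴ

theorem proj_isHermitian (h : Channel L M) (ψ : Ψ) (k : Fin Q) :
    (proj h ψ k).IsHermitian := by
  have h1 : ((others h ψ k)ᵀ * (others h ψ k)ᵀᴴ).IsHermitian :=
    isHermitian_mul_conjTranspose_self _
  exact isHermitian_one.sub (isHermitian_conjTranspose_mul_mul _ h1.inv)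

theorem effGram_isHermitian (h : Channel L M) (ψ : Ψ) (k : Fin Q) :
    (effGram h ψ k).IsHermitian :=
  isHermitian_mul_mul_conjTranspose _ (proj_isHermitian h ψ k)

/-- The eigenvalues, with multiplicity, of `Hᵀ T H*`. -/
def eigval (h : Channel L M) (ψ : Ψ) (k : Fin Q) : Fin (M ψ k) → ℝ :=
  (effGram_isHermitian h ψ k).eigenvalues

/-- `x / ‖x‖` for the Euclidean norm. -/
def unit {n : Type*} [Fintype n] (x : n → ℂ) : n → ℂ :=
  ((‖WithLp.toLp 2 x‖⁻¹ : ℝ) : ℂ) • x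

/-- The directions `m` define a BD-MRC design with `M ψ k` streams for every user: they are
nonzero, pairwise orthogonal eigenvectors of `T H* Hᵀ T` for nonzero eigenvalues. -/
def IsDesign (h : Channel L M) (m : Directions L M) : Prop :=
  ∀ (ψ : Ψ) (k : Fin Q),
    (∀ q, m ψ k q ≠ 0) ∧
    (∀ p q, p ≠ q → star (m ψ k p) ⬝ᵥ m ψ k q = 0) ∧
    (∀ q, ∃ l : ℝ, l ≠ 0 ∧
      (proj h ψ k * (h ψ k)ᵀᴴ * (h ψ k)ᵀ * proj h ψ k) *ᵥ m ψ k q = (l : ℂ) • m ψ k q)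

/-- The unit-norm BD precoding vector of stream `q` of user `(ψ, k)`. -/
def precoder (h : Channel L M) (m : Directions L M) (ψ : Ψ) (k : Fin Q) (q : Fin (M ψ k)) :
    Fin L → ℂ :=
  unit (proj h ψ k *ᵥ m ψ k q)

/-- The unit-norm maximum ratio combiner of stream `q` of user `(ψ, k)`. -/
def combiner (h : Channel L M) (m : Directions L M) (ψ : Ψ) (k : Fin Q) (q : Fin (M ψ k)) :
    Fin (M ψ k) → ℂ :=
  unit ((h ψ k)ᵀ *ᵥ precoder h m ψ k q)

/-- The gain with which stream `p` of user `(ψ, j)` arrives, after combining, in the decision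
variable of stream `q` of user `(ψ, k)`. -/
def gain (h : Channel L M) (m : Directions L M) (ψ : Ψ) (k : Fin Q) (q : Fin (M ψ k))
    (j : Fin Q) (p : Fin (M ψ j)) : ℝ :=
  ‖star (combiner h m ψ k q) ⬝ᵥ ((h ψ k)ᵀ *ᵥ precoder h m ψ j p)‖ ^ 2

/-- The SINR of stream `q` of user `(ψ, k)` after the removal of the inter-group interference by
means of the cached content. Both the interference between the streams of the user and that
from the other users of its group are accounted for; the precoding is what suppresses them. -/
def sinr (N₀ : ℝ) (h : Channel L M) (m : Directions L M) (P : Powers M)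
    (ψ : Ψ) (k : Fin Q) (q : Fin (M ψ k)) : ℝ :=
  P ψ k q * gain h m ψ k q k q /
    (N₀ + (∑ p ∈ Finset.univ.erase q, P ψ k p * gain h m ψ k q k p)
      + ∑ j ∈ Finset.univ.erase k, ∑ p, P ψ j p * gain h m ψ k q j p)

variable [Fintype Ψ]

/-- The effective rate of user `(ψ, k)`. -/
def rate (Θ T N₀ : ℝ) (h : Channel L M) (m : Directions L M) (P : Powers M)
    (ψ : Ψ) (k : Fin Q) : ℝ :=
  csiFactor M Θ T * ∑ q, Real.log (1 + sinr N₀ h m P ψ k q)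

/-- The effective sum-rate over all served users. -/
def sumRate (Θ T N₀ : ℝ) (h : Channel L M) (m : Directions L M) (P : Powers M) : ℝ :=
  ∑ ψ, ∑ k, rate Θ T N₀ h m P ψ k

/-- The smallest effective rate among the served users. -/
def minRate (Θ T N₀ : ℝ) (h : Channel L M) (m : Directions L M) (P : Powers M) : ℝ :=
  ⨅ u : Ψ × Fin Q, rate Θ T N₀ h m P u.1 u.2

/-- The total transmit power of an allocation. -/
def totalPower (P : Powers M) : ℝ := ∑ ψ, ∑ k, ∑ q, P ψ k q

/-- Nonnegative powers within the power budget. -/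
def Feasible (Ptot : ℝ) (P : Powers M) : Prop :=
  (∀ ψ k q, 0 ≤ P ψ k q) ∧ totalPower P ≤ Ptot

/-- `P` solves the max-min fairness problem. -/
def IsMMFOptimal (Θ T N₀ Ptot : ℝ) (h : Channel L M) (m : Directions L M) (P : Powers M) : Prop :=
  Feasible Ptot P ∧
    ∀ P' : Powers M, Feasible Ptot P' → minRate Θ T N₀ h m P' ≤ minRate Θ T N₀ h m P

/-- The quantity `β (L - M_ψ + M_{ψ,k})`. -/
def detEig (M : Ψ → Fin Q → ℕ) (β : Ψ → Fin Q → ℝ) (L : ℕ) (ψ : Ψ) (k : Fin Q) : ℝ :=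
  β ψ k * ((L : ℝ) - (groupAntennas M ψ : ℝ) + (M ψ k : ℝ))

/-- The power of each stream of user `(ψ, k)` in the explicit allocation with parameter `R`. -/
def detPower (Θ T N₀ : ℝ) (M : Ψ → Fin Q → ℕ) (β : Ψ → Fin Q → ℝ) (L : ℕ) (R : ℝ) :
    Powers M := fun ψ k _ =>
  N₀ * (Real.exp (R / (csiFactor M Θ T * (M ψ k : ℝ) * numUsers Ψ Q)) - 1) / detEig M β L ψ k

/-- `R` solves the exponential-sum equation for `L` transmit antennas. -/
def SolvesExpEq (Θ T N₀ Ptot : ℝ) (M : Ψ → Fin Q → ℕ) (β : Ψ → Fin Q → ℝ) (L : ℕ) (R : ℝ) :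
    Prop :=
  ∑ ψ, ∑ k, N₀ * (M ψ k : ℝ) *
      (Real.exp (R / (csiFactor M Θ T * (M ψ k : ℝ) * numUsers Ψ Q)) - 1) / detEig M β L ψ k
    = Ptot

/-- The closed-form sum-rate for a common number `M₀` of receive antennas. -/
def closedForm (Θ T N₀ Ptot : ℝ) (M : Ψ → Fin Q → ℕ) (β : Ψ → Fin Q → ℝ) (M₀ L : ℕ) : ℝ :=
  csiFactor M Θ T * numUsers Ψ Q * (M₀ : ℝ) *
    Real.log (1 + Ptot * ((L : ℝ) - ((Q : ℝ) - 1) * (M₀ : ℝ)) /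
      (N₀ * (M₀ : ℝ) * ∑ ψ, ∑ k, (β ψ k)⁻¹))

end Model

end VCC

end

/-!
The randomness enters only through favorable propagation: almost surely the Gram matrix of the
channel columns of a group, divided by `L`, tends to the diagonal matrix of the path gains. Its
entries are averages of independent terms with bounded fourth moments, hence the fourth moments of
their deviations are summable in `L`, and the convergence holds however different `L` are coupled.

The matrix `Hᵀ T H*` of a user is a Schur complement in the Gram matrix of its group. So
`Hᵀ T H* / L` tends to a multiple of the identity, and all eigenvalues are asymptotic to
`β (L - M_ψ + M_{ψ,k})`. Since the precoders are eigenvectors inside the range of the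
projection, all interference vanishes and the streams become parallel channels with these
eigenvalues as gains.

It remains to study max-min fairness over parallel channels whose gains agree, up to a factor `c`
tending to `1`, with one gain per user. For equal gains the inequality of arithmetic and geometric
means makes equal powers optimal, and the factor `c` changes the optimal rate by `O(log c)` only. An
optimal allocation wastes no power on any user, as the saving could be spread over all streams; so
equality nearly holds between the two means, which forces the factors `1 + SINR` of the user, and
with them its powers, to be asymptotically equal.
-/

namespace VCC

/-! ### Favorable propagation -/

section Independence

variable {Ω : Type*} [MeasurableSpace Ω] {μ : Measure Ω}

theorem iIndepFun_curry {ι κ 𝓧 : Type*} [Countable ι] [Countable κ] [MeasurableSpace 𝓧]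
    {X : ι × κ → Ω → 𝓧} (hX : ∀ p, AEMeasurable (X p) μ) (h : iIndepFun X μ) :
    iIndepFun (fun i ω j => X (i, j) ω) μ := by
  have := h.isProbabilityMeasure
  have hprob : ∀ i j, IsProbabilityMeasure (μ.map (X (i, j))) :=
    fun i j => Measure.isProbabilityMeasure_map (hX _)
  have hrow : ∀ i, iIndepFun (fun j => X (i, j)) μ :=
    fun i => h.precomp (g := fun j => (i, j)) (Prod.mk_right_injective i)
  have hcurry : (fun ω i j => X (i, j) ω) = MeasurableEquiv.curry ι κ 𝓧 ∘ fun ω p => X p ω := rfl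
  rw [iIndepFun_iff_map_fun_eq_infinitePi_map₀' fun i => aemeasurable_pi_iff.2 fun j => hX _,
    hcurry, ← AEMeasurable.map_map_of_aemeasurable (by fun_prop) (aemeasurable_pi_iff.2 hX),
    h.map_fun_eq_infinitePi_map₀' hX, Measure.infinitePi_map_curry fun i j => μ.map (X (i, j))]
  congr 1 with i : 1
  exact ((hrow i).map_fun_eq_infinitePi_map₀' fun j => hX _).symm

end Independence

section StrongLaw

variable {Ω ι : Type*} [MeasurableSpace Ω] {μ : Measure Ω}

theorem integrable_pow_of_memLp [IsFiniteMeasure μ] {X : Ω → ℝ} {n k : ℕ} (hX : MemLp X n μ)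
    (hk : k ≤ n) : Integrable (fun ω => X ω ^ k) μ := by
  have hXk : MemLp X k μ := hX.mono_exponent (by exact_mod_cast hk)
  exact hXk.integrable_norm_pow'.mono (hX.aestronglyMeasurable.pow k)
    (ae_of_all _ fun ω => by simp)

theorem sq_integral_sq_le_integral_pow_four [IsProbabilityMeasure μ] {X : Ω → ℝ}
    (hX : MemLp X 4 μ) : (∫ ω, X ω ^ 2 ∂μ) ^ 2 ≤ ∫ ω, X ω ^ 4 ∂μ := by
  have hX2 : MemLp (fun ω => X ω ^ 2) 2 μ := by
    refine (memLp_two_iff_integrable_sq (hX.aestronglyMeasurable.pow 2)).2 ?_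
    simpa only [Pi.pow_apply, ← pow_mul] using integrable_pow_of_memLp (n := 4) hX le_rfl
  have h := variance_nonneg (fun ω => X ω ^ 2) μ
  rw [variance_eq_sub hX2] at h
  simp only [Pi.pow_apply, ← pow_mul] at h
  linarith

theorem integral_add_pow_four_of_indepFun [IsProbabilityMeasure μ] {X Y : Ω → ℝ}
    (h : X ⟂ᵢ[μ] Y) (hX : MemLp X 4 μ) (hY : MemLp Y 4 μ)
    (hX0 : ∫ ω, X ω ∂μ = 0) (hY0 : ∫ ω, Y ω ∂μ = 0) :
    ∫ ω, (X ω + Y ω) ^ 4 ∂μ =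
      ∫ ω, X ω ^ 4 ∂μ + 6 * ((∫ ω, X ω ^ 2 ∂μ) * ∫ ω, Y ω ^ 2 ∂μ) + ∫ ω, Y ω ^ 4 ∂μ := by
  have hint (j k : ℕ) (hj : j ≤ 4) (hk : k ≤ 4) :
      Integrable (fun ω => X ω ^ j * Y ω ^ k) μ :=
    (h.comp (measurable_id.pow_const j) (measurable_id.pow_const k)).integrable_mul
      (integrable_pow_of_memLp (n := 4) hX hj) (integrable_pow_of_memLp (n := 4) hY hk)
  have hprod (j k : ℕ) : ∫ ω, X ω ^ j * Y ω ^ k ∂μ = (∫ ω, X ω ^ j ∂μ) * ∫ ω, Y ω ^ k ∂μ :=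
    h.integral_fun_comp_mul_comp (f := fun x => x ^ j) (g := fun x => x ^ k)
      hX.aestronglyMeasurable.aemeasurable hY.aestronglyMeasurable.aemeasurable
      (by fun_prop) (by fun_prop)
  simp_rw [add_pow]
  rw [integral_finsetSum _ fun m hm => (hint m (4 - m) (by grind) (by omega)).mul_const _]
  simp only [integral_mul_const, hprod, Finset.sum_range_succ, Finset.sum_range_zero]
  norm_num [hX0, hY0, Nat.choose]
  ring

theorem integral_sum_sq_le {X : ι → Ω → ℝ} (h : iIndepFun X μ) (hX : ∀ i, MemLp (X i) 2 μ)
    (h0 : ∀ i, ∫ ω, X i ω ∂μ = 0) {v : ℝ} (hv : ∀ i, ∫ ω, X i ω ^ 2 ∂μ ≤ v) (s : Finset ι) :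
    ∫ ω, (∑ i ∈ s, X i ω) ^ 2 ∂μ ≤ s.card * v := by
  have := h.isProbabilityMeasure
  have hvar : ∀ {Y : Ω → ℝ}, MemLp Y 2 μ → ∫ ω, Y ω ∂μ = 0 → Var[Y; μ] = ∫ ω, Y ω ^ 2 ∂μ :=
    fun hY hY0 => variance_of_integral_eq_zero hY.aestronglyMeasurable.aemeasurable hY0
  have hS0 : ∫ ω, (∑ i ∈ s, X i) ω ∂μ = 0 := by
    simp_rw [Finset.sum_apply]
    rw [integral_finsetSum _ fun i _ => (hX i).integrable one_le_two]
    exact Finset.sum_eq_zero fun i _ => h0 i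
  calc ∫ ω, (∑ i ∈ s, X i ω) ^ 2 ∂μ = Var[∑ i ∈ s, X i; μ] := by
        rw [hvar (memLp_finsetSum' s fun i _ => hX i) hS0]
        simp only [Finset.sum_apply]
    _ = ∑ i ∈ s, ∫ ω, X i ω ^ 2 ∂μ := by
        rw [IndepFun.variance_sum (fun i _ => hX i) fun i _ j _ hij => h.indepFun hij]
        exact Finset.sum_congr rfl fun i _ => hvar (hX i) (h0 i)
    _ ≤ s.card * v := by
        simpa only [nsmul_eq_mul] using Finset.sum_le_card_nsmul s _ v fun i _ => hv i

theorem integral_sum_pow_four_le {X : ι → Ω → ℝ} (h : iIndepFun X μ) (hX : ∀ i, MemLp (X i) 4 μ)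
    (h0 : ∀ i, ∫ ω, X i ω ∂μ = 0) {K : ℝ} (hK : ∀ i, ∫ ω, X i ω ^ 4 ∂μ ≤ K) (s : Finset ι) :
    ∫ ω, (∑ i ∈ s, X i ω) ^ 4 ∂μ ≤ 3 * (s.card : ℝ) ^ 2 * K := by
  classical
  have := h.isProbabilityMeasure
  induction s using Finset.induction_on with
  | empty => simp
  | insert a s ha ih =>
    have hK0 : 0 ≤ K := (integral_nonneg fun ω => by positivity).trans (hK a)
    have hv : ∀ i, ∫ ω, X i ω ^ 2 ∂μ ≤ √K := fun i =>
      Real.le_sqrt_of_sq_le ((sq_integral_sq_le_integral_pow_four (hX i)).trans (hK i))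
    have hX2 : ∀ i, MemLp (X i) 2 μ := fun i => (hX i).mono_exponent (by norm_num)
    have hS0 : ∫ ω, ∑ i ∈ s, X i ω ∂μ = 0 := by
      rw [integral_finsetSum _ fun i _ => (hX2 i).integrable one_le_two]
      exact Finset.sum_eq_zero fun i _ => h0 i
    have hind : IndepFun (fun ω => ∑ i ∈ s, X i ω) (X a) μ := by
      simpa only [← Finset.sum_apply] using h.indepFun_finsetSum_of_notMem₀
        (fun i => (hX i).aestronglyMeasurable.aemeasurable) ha
    have hcross : (∫ ω, (∑ i ∈ s, X i ω) ^ 2 ∂μ) * ∫ ω, X a ω ^ 2 ∂μ ≤ s.card * √K * √K :=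
      mul_le_mul (integral_sum_sq_le h hX2 h0 hv s) (hv a)
        (integral_nonneg fun ω => sq_nonneg _) (by positivity)
    simp_rw [Finset.sum_insert ha, add_comm (X a _), Finset.card_insert_of_notMem ha]
    rw [integral_add_pow_four_of_indepFun hind (memLp_finsetSum s fun i _ => hX i) (hX a) hS0
      (h0 a)]
    rw [mul_assoc, Real.mul_self_sqrt hK0] at hcross
    push_cast
    linarith [hK a]

/-- The averages have fourth moments at most `3 K / L ^ 2`, which is summable, so they converge
almost surely however the rows are coupled. -/
theorem ae_tendsto_average_zero {X : ∀ L : ℕ, Fin L → Ω → ℝ} (h : ∀ L, iIndepFun (X L) μ)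
    (hX : ∀ L i, MemLp (X L i) 4 μ) (h0 : ∀ L i, ∫ ω, X L i ω ∂μ = 0) {K : ℝ}
    (hK : ∀ L i, ∫ ω, X L i ω ^ 4 ∂μ ≤ K) :
    ∀ᵐ ω ∂μ, Tendsto (fun L : ℕ => (∑ i, X L i ω) / L) atTop (𝓝 0) := by
  have := (h 0).isProbabilityMeasure
  set V : ℕ → Ω → ℝ := fun L ω => ((∑ i, X L i ω) / L) ^ 4
  have hVint : ∀ L, Integrable (V L) μ := fun L => by
    simp only [V, div_pow]
    exact (integrable_pow_of_memLp (n := 4) (memLp_finsetSum _ fun i _ => hX L i)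
      le_rfl).div_const _
  have hVnorm : ∀ L ω, ‖V L ω‖ = V L ω := fun L ω => Real.norm_of_nonneg (by positivity)
  have hVle : ∀ L : ℕ, ∫ ω, V L ω ∂μ ≤ 3 * K * (1 / (L : ℝ) ^ 2) := by
    intro L
    rcases Nat.eq_zero_or_pos L with rfl | hL
    · simp [V]
    have hsum := integral_sum_pow_four_le (h L) (hX L) (h0 L) (hK L) Finset.univ
    simp only [V, div_pow, integral_div, Finset.card_univ, Fintype.card_fin] at hsum ⊢
    rw [div_le_iff₀ (by positivity)]
    refine hsum.trans_eq ?_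
    field_simp
  have hfin : ∑' L, eLpNorm (V L) 1 μ ≠ ⊤ := by
    refine ne_top_of_le_ne_top ((Real.summable_one_div_nat_pow.2 one_lt_two).mul_left
      (3 * K)).tsum_ofReal_ne_top (ENNReal.tsum_le_tsum fun L => ?_)
    rw [eLpNorm_one_eq_lintegral_enorm, ← ofReal_integral_norm_eq_lintegral_enorm (hVint L)]
    simp only [hVnorm]
    exact ENNReal.ofReal_le_ofReal (hVle L)
  filter_upwards [summable_norm_of_tsum_eLpNorm_ne_top le_rfl
    (fun L => (hVint L).aestronglyMeasurable) hfin] with ω hω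
  have hroot := hω.tendsto_atTop_zero.rpow_const (p := ((4 : ℕ) : ℝ)⁻¹) (Or.inr (by positivity))
  rw [Real.zero_rpow (by norm_num)] at hroot
  refine tendsto_zero_iff_norm_tendsto_zero.2 (hroot.congr fun L => ?_)
  rw [norm_pow, Real.pow_rpow_inv_natCast (norm_nonneg _) four_ne_zero]

theorem integral_norm_sub_pow_four_le [IsProbabilityMeasure μ] {E : Type*} [NormedAddCommGroup E]
    {X : Ω → E} (hX : MemLp X 4 μ) (b : E) :
    ∫ ω, ‖X ω - b‖ ^ 4 ∂μ ≤ 8 * (∫ ω, ‖X ω‖ ^ 4 ∂μ + ‖b‖ ^ 4) := by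
  have hint : Integrable (fun ω => ‖X ω‖ ^ 4) μ := MemLp.integrable_norm_pow' (p := 4) hX
  have hsub : Integrable (fun ω => ‖X ω - b‖ ^ 4) μ :=
    MemLp.integrable_norm_pow' (p := 4) (hX.sub (memLp_const b))
  calc ∫ ω, ‖X ω - b‖ ^ 4 ∂μ ≤ ∫ ω, 8 * (‖X ω‖ ^ 4 + ‖b‖ ^ 4) ∂μ := by
        refine integral_mono hsub ((hint.add (integrable_const _)).const_mul 8) fun ω => ?_
        calc ‖X ω - b‖ ^ 4 ≤ (‖X ω‖ + ‖b‖) ^ 4 := by gcongr; exact norm_sub_le _ _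
          _ ≤ 2 ^ 3 * (‖X ω‖ ^ 4 + ‖b‖ ^ 4) := add_pow_le (norm_nonneg _) (norm_nonneg _) 4
          _ = _ := by norm_num
    _ = 8 * (∫ ω, ‖X ω‖ ^ 4 ∂μ + ‖b‖ ^ 4) := by
        rw [integral_const_mul, integral_add hint (integrable_const _)]
        simp

theorem ae_tendsto_complex_average_zero {X : ∀ L : ℕ, Fin L → Ω → ℂ} (h : ∀ L, iIndepFun (X L) μ)
    (hX : ∀ L i, MemLp (X L i) 4 μ) (h0 : ∀ L i, ∫ ω, X L i ω ∂μ = 0) {K : ℝ}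
    (hK : ∀ L i, ∫ ω, ‖X L i ω‖ ^ 4 ∂μ ≤ K) :
    ∀ᵐ ω ∂μ, Tendsto (fun L : ℕ => (∑ i, X L i ω) / (L : ℂ)) atTop (𝓝 0) := by
  have := (h 0).isProbabilityMeasure
  have hcoord : ∀ f : ℂ →L[ℝ] ℝ, (∀ z, |f z| ≤ ‖z‖) →
      ∀ᵐ ω ∂μ, Tendsto (fun L : ℕ => (∑ i, f (X L i ω)) / L) atTop (𝓝 0) := by
    intro f hf
    have hfX : ∀ L i, MemLp (fun ω => f (X L i ω)) 4 μ := fun L i => f.comp_memLp' (hX L i)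
    refine ae_tendsto_average_zero (K := K)
      (fun L => (h L).comp (fun _ => f) fun _ => by fun_prop) hfX (fun L i => ?_) fun L i => ?_
    · rw [f.integral_comp_comm ((hX L i).integrable (by norm_num)), h0, map_zero]
    · refine (integral_mono (integrable_pow_of_memLp (n := 4) (hfX L i) le_rfl)
        (MemLp.integrable_norm_pow' (p := 4) (hX L i)) fun ω => ?_).trans (hK L i)
      exact (Even.pow_abs (by decide) _).symm.trans_le (pow_le_pow_left₀ (abs_nonneg _) (hf _) 4)
  filter_upwards [hcoord Complex.reCLM Complex.abs_re_le_norm,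
    hcoord Complex.imCLM Complex.abs_im_le_norm] with ω hre him
  refine squeeze_zero_norm (fun L => ?_) (by simpa using hre.abs.add him.abs)
  simpa using Complex.norm_le_abs_re_add_abs_im ((∑ i, X L i ω) / (L : ℂ))

theorem ae_tendsto_complex_average {X : ∀ L : ℕ, Fin L → Ω → ℂ} (h : ∀ L, iIndepFun (X L) μ)
    (hX : ∀ L i, MemLp (X L i) 4 μ) {b : ℂ} (hb : ∀ L i, ∫ ω, X L i ω ∂μ = b) {K : ℝ}
    (hK : ∀ L i, ∫ ω, ‖X L i ω‖ ^ 4 ∂μ ≤ K) :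
    ∀ᵐ ω ∂μ, Tendsto (fun L : ℕ => (∑ i, X L i ω) / (L : ℂ)) atTop (𝓝 b) := by
  have := (h 0).isProbabilityMeasure
  have hmean : ∀ L i, ∫ ω, (X L i ω - b) ∂μ = 0 := fun L i => by
    rw [integral_sub ((hX L i).integrable (by norm_num)) (integrable_const b), hb]
    simp
  have hbound : ∀ L i, ∫ ω, ‖X L i ω - b‖ ^ 4 ∂μ ≤ 8 * (K + ‖b‖ ^ 4) := fun L i =>
    (integral_norm_sub_pow_four_le (hX L i) b).trans (by gcongr; exact hK L i)
  filter_upwards [ae_tendsto_complex_average_zero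
    (fun L => (h L).comp (fun _ z => z - b) fun _ => by fun_prop)
    (fun L i => (hX L i).sub (memLp_const b)) hmean hbound] with ω hω
  have hadd := hω.add_const b
  rw [zero_add] at hadd
  refine hadd.congr' ?_
  filter_upwards [eventually_gt_atTop 0] with L hL
  have hL0 : (L : ℂ) ≠ 0 := by exact_mod_cast hL.ne'
  simp only [Function.comp_apply, Finset.sum_sub_distrib, Finset.sum_const, Finset.card_univ,
    Fintype.card_fin, nsmul_eq_mul]
  field_simp
  ring

end StrongLaw

section ComplexGaussian

instance complexGaussian.isProbabilityMeasure (v : ℝ) : IsProbabilityMeasure (complexGaussian v) :=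
  Measure.isProbabilityMeasure_map (by fun_prop)

theorem measurePreserving_equivRealProd_complexGaussian (v : ℝ) :
    MeasurePreserving Complex.measurableEquivRealProd (complexGaussian v)
      ((gaussianReal 0 (v / 2).toNNReal).prod (gaussianReal 0 (v / 2).toNNReal)) :=
  (Complex.measurableEquivRealProd.symm.measurable.measurePreserving _).symm _

theorem hasLaw_re_complexGaussian (v : ℝ) :
    HasLaw Complex.re (gaussianReal 0 (v / 2).toNNReal) (complexGaussian v) :=
  (measurePreserving_fst.comp (measurePreserving_equivRealProd_complexGaussian v)).hasLaw

theorem hasLaw_im_complexGaussian (v : ℝ) :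
    HasLaw Complex.im (gaussianReal 0 (v / 2).toNNReal) (complexGaussian v) :=
  (measurePreserving_snd.comp (measurePreserving_equivRealProd_complexGaussian v)).hasLaw

section HasLaw

variable {Ω : Type*} [MeasurableSpace Ω] {μ : Measure Ω}

theorem memLp_of_hasLaw {E : Type*} [NormedAddCommGroup E] [MeasurableSpace E] [BorelSpace E]
    [SecondCountableTopology E] {ν : Measure E} {X : Ω → E} (hX : HasLaw X ν μ) {p : ENNReal}
    (hν : MemLp id p ν) : MemLp X p μ :=
  (memLp_map_measure_iff aestronglyMeasurable_id hX.aemeasurable).1 (hX.map_eq ▸ hν)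

theorem integral_sq_of_hasLaw_gaussianReal {X : Ω → ℝ} {v : ℝ≥0}
    (hX : HasLaw X (gaussianReal 0 v) μ) : ∫ ω, X ω ^ 2 ∂μ = v := by
  have hmean : ∫ ω, X ω ∂μ = 0 := hX.integral_eq.trans integral_id_gaussianReal
  rw [← variance_of_integral_eq_zero hX.aemeasurable hmean, hX.variance_eq,
    variance_id_gaussianReal]

theorem memLp_id_complexGaussian (v : ℝ) {p : ENNReal} (hp : p ≠ ⊤) :
    MemLp id p (complexGaussian v) :=
  memLp_re_im_iff.1 ⟨memLp_of_hasLaw (hasLaw_re_complexGaussian v) (memLp_id_gaussianReal' p hp),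
    memLp_of_hasLaw (hasLaw_im_complexGaussian v) (memLp_id_gaussianReal' p hp)⟩

theorem integral_id_complexGaussian (v : ℝ) : ∫ z, z ∂complexGaussian v = 0 := by
  have hint : Integrable (fun z : ℂ => z) (complexGaussian v) :=
    (memLp_id_complexGaussian v ENNReal.one_ne_top).integrable le_rfl
  have hre : ∫ z : ℂ, z.re ∂complexGaussian v = 0 :=
    (hasLaw_re_complexGaussian v).integral_eq.trans integral_id_gaussianReal
  have him : ∫ z : ℂ, z.im ∂complexGaussian v = 0 :=
    (hasLaw_im_complexGaussian v).integral_eq.trans integral_id_gaussianReal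
  rw [← integral_re_add_im hint]
  simp [hre, him]

theorem integral_mul_star_complexGaussian {v : ℝ} (hv : 0 ≤ v) :
    ∫ z, z * star z ∂complexGaussian v = v := by
  have hmem : MemLp (fun z : ℂ => z) 2 (complexGaussian v) :=
    memLp_id_complexGaussian v ENNReal.ofNat_ne_top
  have hre : Integrable (fun z : ℂ => z.re ^ 2) (complexGaussian v) := hmem.re.integrable_sq
  have him : Integrable (fun z : ℂ => z.im ^ 2) (complexGaussian v) := hmem.im.integrable_sq
  have hsq : ∀ z : ℂ, z * star z = ((z.re ^ 2 + z.im ^ 2 : ℝ) : ℂ) := fun z => by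
    rw [Complex.star_def, Complex.mul_conj, Complex.normSq_apply, sq, sq]
  simp_rw [hsq]
  rw [integral_complex_ofReal, integral_add hre him,
    integral_sq_of_hasLaw_gaussianReal (hasLaw_re_complexGaussian v),
    integral_sq_of_hasLaw_gaussianReal (hasLaw_im_complexGaussian v),
    Real.coe_toNNReal _ (by positivity), add_halves]

end HasLaw

end ComplexGaussian

section Rayleigh

variable {Ω : Type*} [MeasurableSpace Ω] {μ : Measure Ω}

theorem memLp_mul_star {Z W : Ω → ℂ} (hZ : MemLp Z 8 μ) (hW : MemLp W 8 μ) :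
    MemLp (fun ω => Z ω * star (W ω)) 4 μ := by
  have : ENNReal.HolderTriple 8 8 4 := ⟨by
    rw [← two_mul, show (8 : ENNReal) = 2 * 4 by norm_num, ENNReal.mul_inv (by simp) (by simp),
      ← mul_assoc, ENNReal.mul_inv_cancel (by simp) (by simp), one_mul]⟩
  exact hW.star.mul hZ

theorem integral_norm_mul_star_pow_four_le {Z W : Ω → ℂ} [IsFiniteMeasure μ] (hZ : MemLp Z 8 μ)
    (hW : MemLp W 8 μ) :
    ∫ ω, ‖Z ω * star (W ω)‖ ^ 4 ∂μ ≤ ∫ ω, ‖Z ω‖ ^ 8 ∂μ + ∫ ω, ‖W ω‖ ^ 8 ∂μ := by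
  have hZ8 : Integrable (fun ω => ‖Z ω‖ ^ 8) μ := MemLp.integrable_norm_pow' (p := 8) hZ
  have hW8 : Integrable (fun ω => ‖W ω‖ ^ 8) μ := MemLp.integrable_norm_pow' (p := 8) hW
  rw [← integral_add hZ8 hW8]
  refine integral_mono (MemLp.integrable_norm_pow' (p := 4) (memLp_mul_star hZ hW))
    (hZ8.add hW8) fun ω => ?_
  simp only [norm_mul, norm_star, mul_pow]
  nlinarith [sq_nonneg (‖Z ω‖ ^ 4 - ‖W ω‖ ^ 4), sq_nonneg (‖Z ω‖ ^ 4 + ‖W ω‖ ^ 4)]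

variable {Ψ : Type*} {Q : ℕ} {M : Ψ → Fin Q → ℕ} {β : Ψ → Fin Q → ℝ}

theorem IsRayleigh.memLp {L : ℕ} {H : Ω → Channel L M} (hH : IsRayleigh μ β H) (ψ : Ψ)
    (k : Fin Q) (i : Fin L) (j : Fin (M ψ k)) {p : ENNReal} (hp : p ≠ ⊤) :
    MemLp (fun ω => H ω ψ k i j) p μ :=
  memLp_of_hasLaw (hH.law ψ k i j) (memLp_id_complexGaussian _ hp)

theorem IsRayleigh.iIndepFun_antennas {L : ℕ} {H : Ω → Channel L M} (hH : IsRayleigh μ β H)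
    (ψ : Ψ) :
    iIndepFun (fun (i : Fin L) ω (c : Σ k, Fin (M ψ k)) => H ω ψ c.1 i c.2) μ := by
  refine iIndepFun_curry (X := fun (p : Fin L × Σ k, Fin (M ψ k)) ω => H ω ψ p.2.1 p.1 p.2.2)
    (fun p => (hH.law ψ p.2.1 p.1 p.2.2).aemeasurable) (hH.indep.precomp
      (g := fun p : Fin L × Σ k, Fin (M ψ k) =>
        (⟨(ψ, p.2.1), (p.1, p.2.2)⟩ : Σ u : Ψ × Fin Q, Fin L × Fin (M u.1 u.2))) ?_)
  rintro ⟨i, k, j⟩ ⟨i', k', j'⟩ heq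
  grind

theorem IsRayleigh.integral_mul_star {L : ℕ} {H : Ω → Channel L M} (hH : IsRayleigh μ β H)
    {ψ : Ψ} (hβ : ∀ k, 0 ≤ β ψ k) (i : Fin L) (c d : Σ k, Fin (M ψ k)) :
    ∫ ω, H ω ψ c.1 i c.2 * star (H ω ψ d.1 i d.2) ∂μ = if c = d then (β ψ c.1 : ℂ) else 0 := by
  have hc := hH.law ψ c.1 i c.2
  have hd := hH.law ψ d.1 i d.2
  split_ifs with hcd
  · subst hcd
    rw [← integral_mul_star_complexGaussian (hβ c.1)]
    exact hc.integral_comp (f := fun z => z * star z) (by fun_prop)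
  · have hind : IndepFun (fun ω => H ω ψ c.1 i c.2) (fun ω => H ω ψ d.1 i d.2) μ :=
      hH.indep.indepFun (i := ⟨(ψ, c.1), (i, c.2)⟩) (j := ⟨(ψ, d.1), (i, d.2)⟩) fun h => hcd <| by
        obtain ⟨k, j⟩ := c
        obtain ⟨k', j'⟩ := d
        grind
    rw [hind.integral_fun_comp_mul_comp (f := fun z => z) (g := fun z => star z) hc.aemeasurable
      hd.aemeasurable (by fun_prop) (by fun_prop), hc.integral_eq, integral_id_complexGaussian,
      zero_mul]

/-- The Gram matrix of the columns of all channels of group `ψ`, with the conjugation on the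
second factor as in `Hᵀ H*`. -/
def groupGram {L : ℕ} (h : Channel L M) (ψ : Ψ) :
    Matrix (Σ k, Fin (M ψ k)) (Σ k, Fin (M ψ k)) ℂ :=
  fun c d => ∑ i, h ψ c.1 i c.2 * star (h ψ d.1 i d.2)

/-- Favorable propagation: within each group the normalized Gram matrix of the channel columns
converges to the diagonal matrix of the path gains. -/
def FavorablePropagation (β : Ψ → Fin Q → ℝ) (h : ∀ L : ℕ, Channel L M) : Prop :=
  ∀ ψ, Tendsto (fun L : ℕ => (L : ℂ)⁻¹ • groupGram (h L) ψ) atTop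
    (𝓝 (diagonal fun c => (β ψ c.1 : ℂ)))

theorem ae_favorablePropagation [Countable Ψ] (hβ : ∀ ψ k, 0 ≤ β ψ k)
    {H : ∀ L : ℕ, Ω → Channel L M} (hH : ∀ L : ℕ, IsRayleigh μ β (H L)) :
    ∀ᵐ ω ∂μ, FavorablePropagation β fun L => H L ω := by
  have := (hH 0).indep.isProbabilityMeasure
  have hmem (L ψ k) (i : Fin L) (j : Fin (M ψ k)) : MemLp (fun ω => H L ω ψ k i j) 8 μ :=
    (hH L).memLp ψ k i j ENNReal.ofNat_ne_top
  have hmoment (L ψ k) (i : Fin L) (j : Fin (M ψ k)) :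
      ∫ ω, ‖H L ω ψ k i j‖ ^ 8 ∂μ = ∫ z, ‖z‖ ^ 8 ∂complexGaussian (β ψ k) :=
    ((hH L).law ψ k i j).integral_comp (f := fun z => ‖z‖ ^ 8) (by fun_prop)
  suffices hentry : ∀ ψ (c d : Σ k, Fin (M ψ k)), ∀ᵐ ω ∂μ, Tendsto
      (fun L : ℕ => (∑ i, H L ω ψ c.1 i c.2 * star (H L ω ψ d.1 i d.2)) / (L : ℂ)) atTop
      (𝓝 (if c = d then (β ψ c.1 : ℂ) else 0)) by
    filter_upwards [ae_all_iff.2 fun ψ => ae_all_iff.2 fun c => ae_all_iff.2 fun d =>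
      hentry ψ c d] with ω hω ψ
    refine tendsto_pi_nhds.2 fun c => tendsto_pi_nhds.2 fun d => ?_
    rw [diagonal_apply]
    exact (hω ψ c d).congr fun L => div_eq_inv_mul _ _
  intro ψ c d
  refine ae_tendsto_complex_average (K := ∫ z, ‖z‖ ^ 8 ∂complexGaussian (β ψ c.1) +
      ∫ z, ‖z‖ ^ 8 ∂complexGaussian (β ψ d.1))
    (fun L => ((hH L).iIndepFun_antennas ψ).comp (fun _ x => x c * star (x d))
      fun _ => by fun_prop)
    (fun L i => memLp_mul_star (hmem L ψ c.1 i c.2) (hmem L ψ d.1 i d.2))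
    (fun L i => (hH L).integral_mul_star (hβ ψ) i c d) fun L i =>
      (integral_norm_mul_star_pow_four_le (hmem L ψ c.1 i c.2) (hmem L ψ d.1 i d.2)).trans_eq ?_
  rw [hmoment, hmoment]

end Rayleigh

/-! ### Block diagonalization -/

section UnitVectors

variable {n : Type*} [Fintype n]

theorem star_dotProduct_self (x : n → ℂ) : star x ⬝ᵥ x = (‖WithLp.toLp 2 x‖ : ℂ) ^ 2 := by
  rw [dotProduct_comm, ← EuclideanSpace.inner_toLp_toLp]
  exact inner_self_eq_norm_sq_to_K _

theorem star_unit_dotProduct (x y : n → ℂ) :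
    star (unit x) ⬝ᵥ y = (‖WithLp.toLp 2 x‖ : ℂ)⁻¹ * (star x ⬝ᵥ y) := by
  simp [unit, star_smul, smul_dotProduct]

theorem star_unit_dotProduct_self (x : n → ℂ) : star (unit x) ⬝ᵥ x = ‖WithLp.toLp 2 x‖ := by
  rw [star_unit_dotProduct, star_dotProduct_self, sq, ← mul_assoc, inv_mul_mul_self]

theorem star_unit_dotProduct_unit (x y : n → ℂ) :
    star (unit x) ⬝ᵥ unit y =
      (‖WithLp.toLp 2 x‖ : ℂ)⁻¹ * (‖WithLp.toLp 2 y‖ : ℂ)⁻¹ * (star x ⬝ᵥ y) := by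
  rw [star_unit_dotProduct, unit, dotProduct_smul, smul_eq_mul, Complex.ofReal_inv, mul_assoc]

theorem star_unit_dotProduct_unit_self {x : n → ℂ} (hx : x ≠ 0) :
    star (unit x) ⬝ᵥ unit x = 1 := by
  have hnorm : (‖WithLp.toLp 2 x‖ : ℂ) ≠ 0 := by simpa using hx
  rw [star_unit_dotProduct_unit, star_dotProduct_self]
  field_simp

end UnitVectors

section Projections

variable {m n : Type*} [Fintype m] [Fintype n]

theorem star_mulVec_dotProduct_mulVec (A : Matrix m n ℂ) (x y : n → ℂ) :
    star (A *ᵥ x) ⬝ᵥ (A *ᵥ y) = star x ⬝ᵥ ((Aᴴ * A) *ᵥ y) := by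
  rw [star_mulVec, ← dotProduct_mulVec, mulVec_mulVec]

section Eigenvectors

variable {T : Matrix n n ℂ} {B : Matrix m n ℂ}

theorem mulVec_eq_self_of_isIdempotentElem (hT : IsIdempotentElem T) {A : Matrix n n ℂ}
    {x : n → ℂ} {l : ℂ} (hl : l ≠ 0) (hx : (T * A) *ᵥ x = l • x) : T *ᵥ x = x := by
  refine smul_right_injective _ hl ?_
  change l • T *ᵥ x = l • x
  rw [← mulVec_smul, ← hx, mulVec_mulVec, ← Matrix.mul_assoc, hT.eq]

theorem star_mulVec_dotProduct_mulVec_of_mulVec_eq (hT : T.IsHermitian) {x y : n → ℂ} {l : ℂ}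
    (hx : T *ᵥ x = x) (hy : T *ᵥ y = y) (hl : (T * Bᴴ * B * T) *ᵥ y = l • y) :
    star (B *ᵥ x) ⬝ᵥ (B *ᵥ y) = l * (star x ⬝ᵥ y) := by
  conv_lhs => rw [← hx, ← hy]
  rw [mulVec_mulVec, mulVec_mulVec, star_mulVec_dotProduct_mulVec, conjTranspose_mul, hT.eq,
    ← Matrix.mul_assoc, hl, dotProduct_smul, smul_eq_mul]

theorem mulVec_mulVec_of_mulVec_eq {x : n → ℂ} {l : ℂ} (hx : T *ᵥ x = x)
    (hl : (T * Bᴴ * B * T) *ᵥ x = l • x) : (B * T * Bᴴ) *ᵥ (B *ᵥ x) = l • (B *ᵥ x) := by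
  conv_lhs => rw [← hx]
  rw [← mulVec_smul, ← hl]
  simp only [mulVec_mulVec, Matrix.mul_assoc]

end Eigenvectors

variable [DecidableEq m]

theorem exists_ne_zero_mulVec_eq_eigenvalues {A : Matrix m m ℂ} (hA : A.IsHermitian) (q : m) :
    ∃ x ≠ 0, A *ᵥ x = (hA.eigenvalues q : ℂ) • x :=
  ⟨hA.eigenvectorBasis q,
    (WithLp.ofLp_eq_zero 2).not.2 (hA.eigenvectorBasis.orthonormal.ne_zero q),
    hA.mulVec_eigenvectorBasis q⟩

/-- The vectors are `T Bᴴ x` for the members `x` of an orthonormal eigenbasis of `B T Bᴴ`. -/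
theorem exists_orthogonal_eigenvectors {T : Matrix n n ℂ} (hT : IsStarProjection T)
    {B : Matrix m n ℂ} (hB : (B * T * Bᴴ).IsHermitian) (hne : ∀ q, hB.eigenvalues q ≠ 0) :
    ∃ v : m → n → ℂ, (∀ q, v q ≠ 0) ∧ (∀ p q, p ≠ q → star (v p) ⬝ᵥ v q = 0) ∧
      ∀ q, (T * Bᴴ * B * T) *ᵥ v q = (hB.eigenvalues q : ℂ) • v q := by
  set x : m → m → ℂ := fun q => hB.eigenvectorBasis q
  have hx (q) : (B * T * Bᴴ) *ᵥ x q = (hB.eigenvalues q : ℂ) • x q :=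
    hB.mulVec_eigenvectorBasis q
  have hTT : T * T = T := hT.isIdempotentElem
  have hdot (p q) : star (x p) ⬝ᵥ x q = if p = q then 1 else 0 := by
    rw [← orthonormal_iff_ite.1 hB.eigenvectorBasis.orthonormal p q,
      EuclideanSpace.inner_eq_star_dotProduct, dotProduct_comm]
  have hvdot (p q) : star ((T * Bᴴ) *ᵥ x p) ⬝ᵥ ((T * Bᴴ) *ᵥ x q) =
      hB.eigenvalues q * if p = q then 1 else 0 := by
    have hgram : (T * Bᴴ)ᴴ * (T * Bᴴ) = B * T * Bᴴ := by
      rw [conjTranspose_mul, conjTranspose_conjTranspose, ← star_eq_conjTranspose T,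
        hT.isSelfAdjoint.star_eq, Matrix.mul_assoc, ← Matrix.mul_assoc T, hTT, Matrix.mul_assoc]
    rw [star_mulVec_dotProduct_mulVec, hgram, hx, dotProduct_smul, hdot, smul_eq_mul]
  refine ⟨fun q => (T * Bᴴ) *ᵥ x q, fun q hq => hne q ?_, fun p q hpq => ?_, fun q => ?_⟩
  · simpa [hq] using (hvdot q q).symm
  · rw [hvdot, if_neg hpq, mul_zero]
  · have hmul : T * Bᴴ * B * T * (T * Bᴴ) = T * Bᴴ * (B * T * Bᴴ) := by
      simp only [Matrix.mul_assoc]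
      rw [← Matrix.mul_assoc T T, hTT]
    rw [mulVec_mulVec, hmul, ← mulVec_mulVec, hx, mulVec_smul]

variable [DecidableEq n]

/-- The projection onto the kernel of `A`; it is orthogonal when the Gram matrix `A * Aᴴ` of the
rows of `A` is invertible. -/
noncomputable def kernelProj (A : Matrix m n ℂ) : Matrix n n ℂ :=
  1 - Aᴴ * (A * Aᴴ)⁻¹ * A

theorem mul_kernelProj {A : Matrix m n ℂ} (hA : IsUnit (A * Aᴴ).det) : A * kernelProj A = 0 := by
  rw [kernelProj, Matrix.mul_sub, Matrix.mul_one, ← Matrix.mul_assoc, ← Matrix.mul_assoc,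
    mul_nonsing_inv _ hA, Matrix.one_mul, sub_self]

theorem isStarProjection_kernelProj {A : Matrix m n ℂ} (hA : IsUnit (A * Aᴴ).det) :
    IsStarProjection (kernelProj A) where
  isIdempotentElem := by
    change (1 - Aᴴ * (A * Aᴴ)⁻¹ * A) * kernelProj A = kernelProj A
    rw [Matrix.sub_mul, Matrix.one_mul, Matrix.mul_assoc _ A, mul_kernelProj hA, Matrix.mul_zero,
      sub_zero]
  isSelfAdjoint := isHermitian_one.sub
    (isHermitian_conjTranspose_mul_mul A (isHermitian_mul_conjTranspose_self A).inv)

end Projections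

section Design

variable {Ψ : Type*} {Q : ℕ} {M : Ψ → Fin Q → ℕ} {L : ℕ} {h : Channel L M} {m : Directions L M}

/-- The Gram matrix of the channels of the other users of the group, whose inverse enters the
block-diagonalization projection. -/
def othersGram (h : Channel L M) (ψ : Ψ) (k : Fin Q) :
    Matrix (Σ j : {j : Fin Q // j ≠ k}, Fin (M ψ j)) (Σ j : {j : Fin Q // j ≠ k}, Fin (M ψ j)) ℂ :=
  (others h ψ k)ᵀ * (others h ψ k)ᵀᴴ

theorem isStarProjection_proj {ψ : Ψ} {k : Fin Q} (hu : IsUnit (othersGram h ψ k).det) :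
    IsStarProjection (proj h ψ k) :=
  isStarProjection_kernelProj hu

theorem channelT_mul_proj_of_ne {ψ : Ψ} {j k : Fin Q} (hu : IsUnit (othersGram h ψ k).det)
    (hjk : j ≠ k) : (h ψ j)ᵀ * proj h ψ k = 0 := by
  ext q i
  exact congr_fun₂ (mul_kernelProj hu) ⟨⟨j, hjk⟩, q⟩ i

theorem rank_effGram_of_eigval_ne_zero {ψ : Ψ} {k : Fin Q} (hne : ∀ q, eigval h ψ k q ≠ 0) :
    (effGram h ψ k).rank = M ψ k := by
  rw [(effGram_isHermitian h ψ k).rank_eq_card_non_zero_eigs,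
    Fintype.card_congr (Equiv.subtypeUnivEquiv
      (p := fun q => (effGram_isHermitian h ψ k).eigenvalues q ≠ 0) hne),
    Fintype.card_fin]

theorem exists_isDesign (hu : ∀ ψ k, IsUnit (othersGram h ψ k).det)
    (hne : ∀ ψ k q, eigval h ψ k q ≠ 0) : ∃ m : Directions L M, IsDesign h m := by
  choose m hm hdot heig using fun ψ k => exists_orthogonal_eigenvectors
    (isStarProjection_proj (hu ψ k)) (effGram_isHermitian h ψ k) (hne ψ k)
  exact ⟨m, fun ψ k => ⟨hm ψ k, hdot ψ k, fun q => ⟨_, hne ψ k q, heig ψ k q⟩⟩⟩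

theorem IsDesign.proj_mulVec (hm : IsDesign h m) {ψ : Ψ} {k : Fin Q}
    (hu : IsUnit (othersGram h ψ k).det) (q : Fin (M ψ k)) :
    proj h ψ k *ᵥ m ψ k q = m ψ k q := by
  obtain ⟨l, hl, hml⟩ := (hm ψ k).2.2 q
  simp only [Matrix.mul_assoc] at hml
  exact mulVec_eq_self_of_isIdempotentElem (isStarProjection_proj hu).isIdempotentElem
    (Complex.ofReal_ne_zero.2 hl) hml

theorem IsDesign.precoder_eq (hm : IsDesign h m) {ψ : Ψ} {k : Fin Q}
    (hu : IsUnit (othersGram h ψ k).det) (q : Fin (M ψ k)) :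
    precoder h m ψ k q = unit (m ψ k q) := by
  rw [precoder, hm.proj_mulVec hu]

theorem IsDesign.proj_mulVec_precoder (hm : IsDesign h m) {ψ : Ψ} {k : Fin Q}
    (hu : IsUnit (othersGram h ψ k).det) (q : Fin (M ψ k)) :
    proj h ψ k *ᵥ precoder h m ψ k q = precoder h m ψ k q := by
  rw [hm.precoder_eq hu, unit, mulVec_smul, hm.proj_mulVec hu]

theorem IsDesign.star_precoder_dotProduct_precoder (hm : IsDesign h m) {ψ : Ψ} {k : Fin Q}
    (hu : IsUnit (othersGram h ψ k).det) (p q : Fin (M ψ k)) :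
    star (precoder h m ψ k p) ⬝ᵥ precoder h m ψ k q = if p = q then 1 else 0 := by
  rw [hm.precoder_eq hu, hm.precoder_eq hu]
  split_ifs with hpq
  · exact hpq ▸ star_unit_dotProduct_unit_self ((hm ψ k).1 p)
  · rw [star_unit_dotProduct_unit, (hm ψ k).2.1 p q hpq, mul_zero]

theorem IsDesign.exists_mulVec_precoder (hm : IsDesign h m) {ψ : Ψ} {k : Fin Q}
    (hu : IsUnit (othersGram h ψ k).det) (q : Fin (M ψ k)) :
    ∃ l : ℝ, l ≠ 0 ∧ (proj h ψ k * (h ψ k)ᵀᴴ * (h ψ k)ᵀ * proj h ψ k) *ᵥ precoder h m ψ k q =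
      (l : ℂ) • precoder h m ψ k q := by
  obtain ⟨l, hl, hml⟩ := (hm ψ k).2.2 q
  exact ⟨l, hl, by rw [hm.precoder_eq hu, unit, mulVec_smul, hml, smul_comm]⟩

theorem IsDesign.exists_star_channelT_mulVec_dotProduct (hm : IsDesign h m) {ψ : Ψ} {k : Fin Q}
    (hu : IsUnit (othersGram h ψ k).det) (q : Fin (M ψ k)) :
    ∃ l : ℝ, l ≠ 0 ∧
      (∀ p, star ((h ψ k)ᵀ *ᵥ precoder h m ψ k p) ⬝ᵥ ((h ψ k)ᵀ *ᵥ precoder h m ψ k q) =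
        if p = q then (l : ℂ) else 0) ∧
      effGram h ψ k *ᵥ ((h ψ k)ᵀ *ᵥ precoder h m ψ k q) =
        (l : ℂ) • ((h ψ k)ᵀ *ᵥ precoder h m ψ k q) := by
  obtain ⟨l, hl, hv⟩ := hm.exists_mulVec_precoder hu q
  refine ⟨l, hl, fun p => ?_, mulVec_mulVec_of_mulVec_eq (hm.proj_mulVec_precoder hu q) hv⟩
  rw [star_mulVec_dotProduct_mulVec_of_mulVec_eq (proj_isHermitian h ψ k)
    (hm.proj_mulVec_precoder hu p) (hm.proj_mulVec_precoder hu q) hv,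
    hm.star_precoder_dotProduct_precoder hu, mul_ite, mul_one, mul_zero]

theorem gain_self (h : Channel L M) (m : Directions L M) (ψ : Ψ) (k : Fin Q) (q : Fin (M ψ k)) :
    gain h m ψ k q k q = ‖WithLp.toLp 2 ((h ψ k)ᵀ *ᵥ precoder h m ψ k q)‖ ^ 2 := by
  rw [gain, combiner, star_unit_dotProduct_self, Complex.norm_real, norm_norm]

theorem IsDesign.gain_eq_zero_of_user_ne (hm : IsDesign h m) {ψ : Ψ} {j k : Fin Q}
    (hu : IsUnit (othersGram h ψ j).det) (hjk : j ≠ k) (q : Fin (M ψ k)) (p : Fin (M ψ j)) :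
    gain h m ψ k q j p = 0 := by
  rw [gain, ← hm.proj_mulVec_precoder hu, mulVec_mulVec, channelT_mul_proj_of_ne hu hjk.symm]
  simp

theorem IsDesign.gain_eq_zero_of_stream_ne (hm : IsDesign h m) {ψ : Ψ} {k : Fin Q}
    (hu : IsUnit (othersGram h ψ k).det) {p q : Fin (M ψ k)} (hpq : p ≠ q) :
    gain h m ψ k q k p = 0 := by
  obtain ⟨l, -, hdot, -⟩ := hm.exists_star_channelT_mulVec_dotProduct hu p
  rw [gain, combiner, star_unit_dotProduct, hdot, if_neg hpq.symm]
  simp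

theorem IsDesign.exists_effGram_mulVec_eq_gain (hm : IsDesign h m) {ψ : Ψ} {k : Fin Q}
    (hu : IsUnit (othersGram h ψ k).det) (q : Fin (M ψ k)) :
    ∃ x ≠ 0, effGram h ψ k *ᵥ x = (gain h m ψ k q k q : ℂ) • x := by
  obtain ⟨l, hl, hdot, heig⟩ := hm.exists_star_channelT_mulVec_dotProduct hu q
  have hgain : (gain h m ψ k q k q : ℂ) = l := by
    rw [gain_self, Complex.ofReal_pow, ← star_dotProduct_self, hdot, if_pos rfl]
  refine ⟨_, fun h0 => hl ?_, hgain ▸ heig⟩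
  simpa [h0] using (hdot q).symm

theorem IsDesign.sinr_eq (hm : IsDesign h m) (hu : ∀ ψ k, IsUnit (othersGram h ψ k).det)
    (N₀ : ℝ) (P : Powers M) (ψ : Ψ) (k : Fin Q) (q : Fin (M ψ k)) :
    sinr N₀ h m P ψ k q = P ψ k q * (gain h m ψ k q k q / N₀) := by
  have hstreams : ∑ p ∈ Finset.univ.erase q, P ψ k p * gain h m ψ k q k p = 0 :=
    Finset.sum_eq_zero fun p hp => by
      rw [hm.gain_eq_zero_of_stream_ne (hu ψ k) (Finset.ne_of_mem_erase hp), mul_zero]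
  have husers : ∑ j ∈ Finset.univ.erase k, ∑ p, P ψ j p * gain h m ψ k q j p = 0 :=
    Finset.sum_eq_zero fun j hj => Finset.sum_eq_zero fun p _ => by
      rw [hm.gain_eq_zero_of_user_ne (hu ψ j) (Finset.ne_of_mem_erase hj), mul_zero]
  rw [sinr, hstreams, husers, add_zero, add_zero, mul_div_assoc]

end Design

/-! ### Eigenvalue asymptotics -/

section SchurComplement

theorem tendsto_matrix_mul {ι l m n : Type*} [Fintype m] {f : Filter ι} {A : ι → Matrix l m ℂ}
    {B : ι → Matrix m n ℂ} {A₀ : Matrix l m ℂ} {B₀ : Matrix m n ℂ} (hA : Tendsto A f (𝓝 A₀))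
    (hB : Tendsto B f (𝓝 B₀)) : Tendsto (fun x => A x * B x) f (𝓝 (A₀ * B₀)) :=
  have hcont : Continuous fun p : Matrix l m ℂ × Matrix m n ℂ => p.1 * p.2 :=
    continuous_fst.matrix_mul continuous_snd
  hcont.continuousAt.tendsto.comp (hA.prodMk_nhds hB)

/-- The Schur complement, in the principal submatrix of `G` with index map `g`, of the one with
index map `f`. -/
noncomputable def schurComplement {n p r : Type*} [Fintype r] [DecidableEq r]
    (G : Matrix n n ℂ) (g : p → n) (f : r → n) : Matrix p p ℂ :=
  G.submatrix g g - G.submatrix g f * (G.submatrix f f)⁻¹ * G.submatrix f g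

theorem schurComplement_smul {n p r : Type*} [Fintype r] [DecidableEq r] {c : ℂ} (hc : c ≠ 0)
    {G : Matrix n n ℂ} (g : p → n) {f : r → n} (hG : IsUnit (G.submatrix f f).det) :
    schurComplement (c • G) g f = c • schurComplement G g f := by
  have hinv : (c • G.submatrix f f)⁻¹ = c⁻¹ • (G.submatrix f f)⁻¹ :=
    inv_smul' _ (Units.mk0 c hc) hG
  simp only [schurComplement, submatrix_smul, Pi.smul_apply, hinv, smul_sub, Matrix.mul_smul,
    Matrix.smul_mul, smul_smul]
  rw [inv_mul_cancel₀ hc, mul_one]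

variable {ι n p r : Type*} [DecidableEq n] {F : Filter ι} {A : ι → Matrix n n ℂ} {d : n → ℂ}

theorem tendsto_submatrix_of_disjoint (hA : Tendsto A F (𝓝 (diagonal d))) {g : p → n}
    {f : r → n} (hgf : ∀ i j, g i ≠ f j) : Tendsto (fun x => (A x).submatrix g f) F (𝓝 0) := by
  have hzero : (diagonal d).submatrix g f = 0 := by
    ext i j
    exact diagonal_apply_ne _ (hgf i j)
  rw [← hzero]
  exact ((continuous_id.matrix_submatrix g f).tendsto _).comp hA

variable [DecidableEq r]

theorem tendsto_submatrix_diagonal (hA : Tendsto A F (𝓝 (diagonal d))) {f : r → n}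
    (hf : f.Injective) :
    Tendsto (fun x => (A x).submatrix f f) F (𝓝 (diagonal (d ∘ f))) := by
  rw [← submatrix_diagonal d f hf]
  exact ((continuous_id.matrix_submatrix f f).tendsto _).comp hA

variable [Fintype r]

theorem det_diagonal_ne_zero {v : r → ℂ} (hv : ∀ j, v j ≠ 0) : (diagonal v).det ≠ 0 := by
  rw [det_diagonal]
  exact Finset.prod_ne_zero_iff.2 fun j _ => hv j

theorem eventually_isUnit_det_submatrix (hA : Tendsto A F (𝓝 (diagonal d))) {f : r → n}
    (hf : f.Injective) (hd : ∀ j, (d ∘ f) j ≠ 0) :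
    ∀ᶠ x in F, IsUnit ((A x).submatrix f f).det := by
  have hdet := (continuous_id.matrix_det.tendsto _).comp (tendsto_submatrix_diagonal hA hf)
  exact (hdet.eventually_ne (det_diagonal_ne_zero hd)).mono fun _ h => h.isUnit

variable [DecidableEq p]

theorem tendsto_schurComplement (hA : Tendsto A F (𝓝 (diagonal d))) {g : p → n} {f : r → n}
    (hg : g.Injective) (hf : f.Injective) (hgf : ∀ i j, g i ≠ f j) (hd : ∀ j, (d ∘ f) j ≠ 0) :
    Tendsto (fun x => schurComplement (A x) g f) F (𝓝 (diagonal (d ∘ g))) := by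
  have hinv : Tendsto (fun x => ((A x).submatrix f f)⁻¹) F (𝓝 (diagonal (d ∘ f))⁻¹) :=
    (continuousAt_matrix_inv _ (by
      rw [Ring.inverse_eq_inv']
      exact continuousAt_inv₀ (det_diagonal_ne_zero hd))).tendsto.comp
        (tendsto_submatrix_diagonal hA hf)
  simpa only [schurComplement, Matrix.mul_zero, sub_zero] using
    (tendsto_submatrix_diagonal hA hg).sub (tendsto_matrix_mul (tendsto_matrix_mul
      (tendsto_submatrix_of_disjoint hA hgf) hinv)
      (tendsto_submatrix_of_disjoint hA fun i j => (hgf j i).symm))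

end SchurComplement

section Eigenvalues

variable {n : Type*} [Fintype n]

theorem norm_eigenvalue_le_sum {A : Matrix n n ℂ} {x : n → ℂ} (hx : x ≠ 0) {c : ℂ}
    (h : A *ᵥ x = c • x) : ‖c‖ ≤ ∑ i, ∑ j, ‖A i j‖ := by
  classical
  obtain ⟨i, hi⟩ := eigenvalue_mem_ball
    (Module.End.hasEigenvalue_of_hasEigenvector (f := toLin' A) ⟨by simpa using h, hx⟩)
  calc ‖c‖ ≤ ‖A i i‖ + ‖c - A i i‖ := norm_le_norm_add_norm_sub' _ _
    _ ≤ ‖A i i‖ + ∑ j ∈ Finset.univ.erase i, ‖A i j‖ := by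
      gcongr
      exact mem_closedBall_iff_norm.1 hi
    _ = ∑ j, ‖A i j‖ := Finset.add_sum_erase _ (fun j => ‖A i j‖) (Finset.mem_univ i)
    _ ≤ ∑ i, ∑ j, ‖A i j‖ := Finset.single_le_sum (f := fun i => ∑ j, ‖A i j‖)
        (fun i _ => by positivity) (Finset.mem_univ i)

variable [DecidableEq n]

theorem tendsto_eigenvalue_of_tendsto_smul_one {ι : Type*} {F : Filter ι} {A : ι → Matrix n n ℂ}
    {c : ℂ} (hA : Tendsto A F (𝓝 (c • 1))) {l : ι → ℂ}
    (hl : ∀ᶠ x in F, ∃ v ≠ 0, A x *ᵥ v = l x • v) : Tendsto l F (𝓝 c) := by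
  have hcont : Continuous fun B : Matrix n n ℂ => ∑ i, ∑ j, ‖(B - c • 1) i j‖ := by fun_prop
  have hsum := (hcont.tendsto (c • 1)).comp hA
  simp only [sub_self, Matrix.zero_apply, norm_zero, Finset.sum_const_zero] at hsum
  refine tendsto_iff_norm_sub_tendsto_zero.2 (squeeze_zero' (by simp) ?_ hsum)
  filter_upwards [hl] with x ⟨v, hv, hAv⟩
  refine norm_eigenvalue_le_sum hv ?_
  rw [sub_mulVec, hAv, smul_mulVec, one_mulVec, sub_smul]

end Eigenvalues

section DeterministicEquivalent

variable {Ψ : Type*} {Q : ℕ} {M : Ψ → Fin Q → ℕ} {β : Ψ → Fin Q → ℝ}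

theorem detEig_pos {ψ : Ψ} {k : Fin Q} (hβ : 0 < β ψ k) {L : ℕ}
    (h : groupAntennas M ψ < L + M ψ k) : 0 < detEig M β L ψ k := by
  have hreal : (groupAntennas M ψ : ℝ) < L + M ψ k := by exact_mod_cast h
  exact mul_pos hβ (by linarith)

theorem tendsto_detEig_atTop {ψ : Ψ} {k : Fin Q} (hβ : 0 < β ψ k) :
    Tendsto (fun L : ℕ => detEig M β L ψ k) atTop atTop :=
  (tendsto_atTop_add_const_right _ _ (tendsto_atTop_add_const_right _ _
    tendsto_natCast_atTop_atTop)).const_mul_atTop hβ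

theorem tendsto_inv_mul_detEig (M : Ψ → Fin Q → ℕ) (β : Ψ → Fin Q → ℝ) (ψ : Ψ) (k : Fin Q) :
    Tendsto (fun L : ℕ => (L : ℝ)⁻¹ * detEig M β L ψ k) atTop (𝓝 (β ψ k)) := by
  have hlim : Tendsto (fun L : ℕ => β ψ k * (1 + ((M ψ k : ℝ) - groupAntennas M ψ) / L)) atTop
      (𝓝 (β ψ k * (1 + 0))) :=
    ((tendsto_const_div_atTop_nhds_zero_nat _).const_add 1).const_mul _
  rw [add_zero, mul_one] at hlim
  refine hlim.congr' ?_
  filter_upwards [eventually_gt_atTop 0] with L hL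
  have hL0 : (L : ℝ) ≠ 0 := by exact_mod_cast hL.ne'
  rw [detEig]
  field_simp
  ring

/-- The embedding of the columns of the users other than `k` into those of the whole group. -/
def othersColumn (M : Ψ → Fin Q → ℕ) (ψ : Ψ) (k : Fin Q) :
    (Σ j : {j : Fin Q // j ≠ k}, Fin (M ψ j)) → Σ j, Fin (M ψ j) :=
  Sigma.map Subtype.val fun _ => id

theorem othersColumn_injective (M : Ψ → Fin Q → ℕ) (ψ : Ψ) (k : Fin Q) :
    (othersColumn M ψ k).Injective :=
  Subtype.val_injective.sigma_map fun _ => Function.injective_id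

theorem othersGram_eq_submatrix {L : ℕ} (h : Channel L M) (ψ : Ψ) (k : Fin Q) :
    othersGram h ψ k = (groupGram h ψ).submatrix (othersColumn M ψ k) (othersColumn M ψ k) :=
  rfl

theorem effGram_eq_schurComplement {L : ℕ} (h : Channel L M) (ψ : Ψ) (k : Fin Q) :
    effGram h ψ k = schurComplement (groupGram h ψ) (Sigma.mk k) (othersColumn M ψ k) := by
  rw [effGram, proj, Matrix.mul_sub, Matrix.sub_mul, Matrix.mul_one]
  simp only [← Matrix.mul_assoc]
  rw [Matrix.mul_assoc _ (others h ψ k)ᵀ]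
  rfl

variable {h : ∀ L : ℕ, Channel L M} {ψ : Ψ}

theorem FavorablePropagation.eventually_isUnit_det_othersGram (hh : FavorablePropagation β h)
    (hβ : ∀ k, β ψ k ≠ 0) (k : Fin Q) :
    ∀ᶠ L : ℕ in atTop, IsUnit (othersGram (h L) ψ k).det := by
  filter_upwards [eventually_isUnit_det_submatrix (hh ψ) (othersColumn_injective M ψ k)
    fun x => Complex.ofReal_ne_zero.2 (hβ x.1)] with L
    (hL : IsUnit ((L : ℂ)⁻¹ • othersGram (h L) ψ k).det)
  rw [det_smul] at hL
  exact isUnit_of_mul_isUnit_right hL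

theorem FavorablePropagation.tendsto_effGram (hh : FavorablePropagation β h)
    (hβ : ∀ k, β ψ k ≠ 0) (k : Fin Q) :
    Tendsto (fun L : ℕ => (L : ℂ)⁻¹ • effGram (h L) ψ k) atTop (𝓝 ((β ψ k : ℂ) • 1)) := by
  have hschur := tendsto_schurComplement (hh ψ) (sigma_mk_injective (i := k))
    (othersColumn_injective M ψ k) (fun _ x hx => x.1.2 (congrArg Sigma.fst hx).symm)
    fun x => Complex.ofReal_ne_zero.2 (hβ x.1)
  rw [smul_one_eq_diagonal]
  refine hschur.congr' ?_
  filter_upwards [hh.eventually_isUnit_det_othersGram hβ k, eventually_gt_atTop 0] with L hu hL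
  have hL0 : (L : ℂ)⁻¹ ≠ 0 := by simpa using hL.ne'
  rw [effGram_eq_schurComplement, schurComplement_smul hL0]
  rwa [← othersGram_eq_submatrix]

theorem FavorablePropagation.tendsto_eigenvalue_div_detEig (hh : FavorablePropagation β h)
    (hβ : ∀ k, β ψ k ≠ 0) (k : Fin Q) {l : ℕ → ℝ}
    (hl : ∀ᶠ L : ℕ in atTop, ∃ x ≠ 0, effGram (h L) ψ k *ᵥ x = (l L : ℂ) • x) :
    Tendsto (fun L : ℕ => l L / detEig M β L ψ k) atTop (𝓝 1) := by
  have hscaled : Tendsto (fun L : ℕ => (((L : ℝ)⁻¹ * l L : ℝ) : ℂ)) atTop (𝓝 (β ψ k)) := by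
    refine tendsto_eigenvalue_of_tendsto_smul_one (hh.tendsto_effGram hβ k) ?_
    filter_upwards [hl] with L ⟨x, hx, hlx⟩
    refine ⟨x, hx, ?_⟩
    rw [smul_mulVec, hlx, smul_smul]
    push_cast
    rfl
  have hdiv := (Complex.continuous_re.tendsto _ |>.comp hscaled).div
    (tendsto_inv_mul_detEig M β ψ k) (hβ k)
  rw [Complex.ofReal_re, div_self (hβ k)] at hdiv
  refine hdiv.congr' ?_
  filter_upwards [eventually_gt_atTop 0] with L hL
  exact mul_div_mul_left _ _ (by positivity)

theorem FavorablePropagation.tendsto_eigval_div_detEig (hh : FavorablePropagation β h)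
    (hβ : ∀ k, β ψ k ≠ 0) (k : Fin Q) (q : Fin (M ψ k)) :
    Tendsto (fun L : ℕ => eigval (h L) ψ k q / detEig M β L ψ k) atTop (𝓝 1) :=
  hh.tendsto_eigenvalue_div_detEig hβ k <| Eventually.of_forall fun L =>
    exists_ne_zero_mulVec_eq_eigenvalues (effGram_isHermitian (h L) ψ k) q

theorem FavorablePropagation.eventually_eigval_ne_zero [Finite Ψ] (hh : FavorablePropagation β h)
    (hβ : ∀ ψ k, β ψ k ≠ 0) : ∀ᶠ L : ℕ in atTop, ∀ ψ k q, eigval (h L) ψ k q ≠ 0 := by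
  refine eventually_all.2 fun ψ => eventually_all.2 fun k => eventually_all.2 fun q => ?_
  filter_upwards [(hh.tendsto_eigval_div_detEig (hβ ψ) k q).eventually_ne one_ne_zero] with L hL h0
  exact hL (by rw [h0, zero_div])

theorem FavorablePropagation.eventually_isUnit_det_othersGram_all [Finite Ψ]
    (hh : FavorablePropagation β h) (hβ : ∀ ψ k, β ψ k ≠ 0) :
    ∀ᶠ L : ℕ in atTop, ∀ ψ k, IsUnit (othersGram (h L) ψ k).det :=
  eventually_all.2 fun ψ => eventually_all.2 (hh.eventually_isUnit_det_othersGram (hβ ψ))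

theorem FavorablePropagation.tendsto_gain_div_detEig (hh : FavorablePropagation β h)
    (hβ : ∀ k, β ψ k ≠ 0) {m : ∀ L : ℕ, Directions L M}
    (hm : ∀ᶠ L : ℕ in atTop, IsDesign (h L) (m L)) (k : Fin Q) (q : Fin (M ψ k)) :
    Tendsto (fun L : ℕ => gain (h L) (m L) ψ k q k q / detEig M β L ψ k) atTop (𝓝 1) :=
  hh.tendsto_eigenvalue_div_detEig hβ k <| by
    filter_upwards [hm, hh.eventually_isUnit_det_othersGram hβ k] with L hmL hu
    exact hmL.exists_effGram_mulVec_eq_gain hu q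

theorem FavorablePropagation.eventually_rank_effGram_and_exists_isDesign [Finite Ψ]
    (hh : FavorablePropagation β h) (hβ : ∀ ψ k, β ψ k ≠ 0) :
    ∀ᶠ L : ℕ in atTop, (∀ ψ k, (effGram (h L) ψ k).rank = M ψ k) ∧
      ∃ m : Directions L M, IsDesign (h L) m := by
  filter_upwards [hh.eventually_isUnit_det_othersGram_all hβ, hh.eventually_eigval_ne_zero hβ]
    with L hu hne
  exact ⟨fun ψ k => rank_effGram_of_eigval_ne_zero (hne ψ k), exists_isDesign hu hne⟩

end DeterministicEquivalent

/-! ### Max-min fairness over parallel channels -/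

section SingleUser

variable {n : Type*} {a p : n → ℝ} {c d s : ℝ}

/-- The gains `a` agree with the single gain `d` up to the factor `c`. -/
structure WithinFactor (c : ℝ) (a : n → ℝ) (d : ℝ) : Prop where
  one_le : 1 ≤ c
  gain_le : ∀ q, a q ≤ c * d
  le_gain : ∀ q, d ≤ c * a q

theorem WithinFactor.pos (h : WithinFactor c a d) (hd : 0 < d) (q : n) : 0 < a q :=
  pos_of_mul_pos_right (hd.trans_le (h.le_gain q)) (zero_le_one.trans h.one_le)

variable [Fintype n]

/-- The rate, in nats, of a user served over parallel noise-normalized channels of gains `a` with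
powers `p`. -/
noncomputable def logRate (a p : n → ℝ) : ℝ := ∑ q, Real.log (1 + p q * a q)

/-- The power per stream with which `n` parallel channels of gain `d` support the rate `s`. -/
noncomputable def streamPower (n : ℕ) (d s : ℝ) : ℝ := (Real.exp (s / n) - 1) / d

theorem one_le_one_add_mul {x y : ℝ} (hx : 0 ≤ x) (hy : 0 ≤ y) : 1 ≤ 1 + x * y :=
  le_add_of_nonneg_right (mul_nonneg hx hy)

theorem logRate_nonneg (ha : ∀ q, 0 ≤ a q) (hp : ∀ q, 0 ≤ p q) : 0 ≤ logRate a p :=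
  Finset.sum_nonneg fun q _ => Real.log_nonneg (one_le_one_add_mul (hp q) (ha q))

theorem logRate_le_logRate {p' : n → ℝ} (ha : ∀ q, 0 ≤ a q) (hp : ∀ q, 0 ≤ p q)
    (h : ∀ q, p q ≤ p' q) : logRate a p ≤ logRate a p' :=
  Finset.sum_le_sum fun q _ => Real.log_le_log
    (zero_lt_one.trans_le (one_le_one_add_mul (hp q) (ha q))) (by gcongr; exacts [ha q, h q])

theorem logRate_lt_logRate_add_const [Nonempty n] (ha : ∀ q, 0 < a q) (hp : ∀ q, 0 ≤ p q)
    (hc : 0 < c) : logRate a p < logRate a fun q => p q + c := by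
  refine Finset.sum_lt_sum_of_nonempty Finset.univ_nonempty fun q _ => ?_
  have hlt : p q * a q < (p q + c) * a q := mul_lt_mul_of_pos_right (by linarith) (ha q)
  exact Real.log_lt_log (zero_lt_one.trans_le (one_le_one_add_mul (hp q) (ha q).le))
    (by linarith)

theorem streamPower_zero (n : ℕ) (d : ℝ) : streamPower n d 0 = 0 := by simp [streamPower]

theorem strictMono_streamPower {n : ℕ} (hn : 0 < n) (hd : 0 < d) :
    StrictMono (streamPower n d) := by
  intro s t hst
  unfold streamPower
  gcongr

theorem streamPower_nonneg (n : ℕ) (hd : 0 ≤ d) (hs : 0 ≤ s) : 0 ≤ streamPower n d s :=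
  div_nonneg (sub_nonneg.2 (Real.one_le_exp (by positivity))) hd

theorem div_le_mul_streamPower {n : ℕ} (hn : 0 < n) (hd : 0 < d) :
    s / d ≤ n * streamPower n d s := by
  rw [streamPower, ← mul_div_assoc, div_le_div_iff_of_pos_right hd]
  have hexp := mul_le_mul_of_nonneg_left (Real.add_one_le_exp (s / n)) (Nat.cast_nonneg (α := ℝ) n)
  rw [mul_add, mul_div_cancel₀ s (by positivity)] at hexp
  linarith

theorem mul_streamPower_le {n : ℕ} (hn : 0 < n) (hd : 0 < d) (hc : 1 ≤ c) :
    c * streamPower n d s ≤ streamPower n d (s + n * Real.log c) := by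
  have hexp : Real.exp ((s + n * Real.log c) / n) = Real.exp (s / n) * c := by
    rw [add_div, mul_div_cancel_left₀ _ (by positivity), Real.exp_add, Real.exp_log (by linarith)]
  rw [streamPower, streamPower, hexp, ← mul_div_assoc, div_le_div_iff_of_pos_right hd]
  linarith

/-- Summing `y - 1 - log y ≥ 0` over the normalized factors `y = x q / exp (s / n)` gives the
inequality of arithmetic and geometric means, and each single summand is at most the deficit. -/
theorem sub_one_sub_log_le_of_le_sum_log {x : n → ℝ} (hx : ∀ q, 0 < x q)
    (hs : s ≤ ∑ q, Real.log (x q)) (q : n) :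
    x q / Real.exp (s / Fintype.card n) - 1 - Real.log (x q / Real.exp (s / Fintype.card n)) ≤
      (∑ q, x q) / Real.exp (s / Fintype.card n) - Fintype.card n := by
  set E := Real.exp (s / Fintype.card n) with hE
  have : Nonempty n := ⟨q⟩
  have hnonneg : ∀ q, 0 ≤ x q / E - 1 - Real.log (x q / E) := fun q => by
    linarith [Real.log_le_sub_one_of_pos (div_pos (hx q) (Real.exp_pos (s / Fintype.card n)))]
  have hlog : ∑ q, Real.log (x q / E) = ∑ q, Real.log (x q) - s := by
    simp only [Real.log_div (hx _).ne' (Real.exp_pos _).ne', hE, Real.log_exp,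
      Finset.sum_sub_distrib, Finset.sum_const, Finset.card_univ, nsmul_eq_mul]
    rw [mul_div_cancel₀ s (by positivity)]
  calc x q / E - 1 - Real.log (x q / E) ≤ ∑ q, (x q / E - 1 - Real.log (x q / E)) :=
        Finset.single_le_sum (f := fun q => x q / E - 1 - Real.log (x q / E))
          (fun q _ => hnonneg q) (Finset.mem_univ q)
    _ = (∑ q, x q) / E - Fintype.card n - (∑ q, Real.log (x q) - s) := by
        simp only [Finset.sum_sub_distrib, ← Finset.sum_div, hlog, Finset.sum_const,
          Finset.card_univ, nsmul_eq_mul, mul_one]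
    _ ≤ _ := by linarith

theorem card_mul_exp_le_of_le_sum_log {x : n → ℝ} (hx : ∀ q, 0 < x q)
    (hs : s ≤ ∑ q, Real.log (x q)) :
    Fintype.card n * Real.exp (s / Fintype.card n) ≤ ∑ q, x q := by
  cases isEmpty_or_nonempty n with
  | inl h => simp
  | inr h =>
    obtain ⟨q⟩ := h
    have hE := Real.exp_pos (s / Fintype.card n)
    have hlog := Real.log_le_sub_one_of_pos (div_pos (hx q) hE)
    rw [← le_div_iff₀ hE]
    linarith [sub_one_sub_log_le_of_le_sum_log hx hs q]

theorem WithinFactor.sum_one_add_le (h : WithinFactor c a d) (hp : ∀ q, 0 ≤ p q) :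
    ∑ q, (1 + p q * a q) ≤ Fintype.card n + c * d * ∑ q, p q := by
  rw [Finset.sum_add_distrib, Finset.mul_sum]
  simp only [Finset.sum_const, Finset.card_univ, nsmul_eq_mul, mul_one, mul_comm (c * d)]
  gcongr with q
  exacts [hp q, h.gain_le q]

theorem WithinFactor.card_mul_streamPower_le (h : WithinFactor c a d) (hd : 0 < d)
    (hp : ∀ q, 0 ≤ p q) (hs : s ≤ logRate a p) :
    Fintype.card n * streamPower (Fintype.card n) d s ≤ c * ∑ q, p q := by
  have hamgm := card_mul_exp_le_of_le_sum_log
    (fun q => zero_lt_one.trans_le (one_le_one_add_mul (hp q) (h.pos hd q).le)) hs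
  rw [streamPower, ← mul_div_assoc, div_le_iff₀ hd]
  linarith [h.sum_one_add_le hp]

theorem WithinFactor.le_logRate_mul_streamPower [Nonempty n] (h : WithinFactor c a d) (hd : 0 < d)
    (hs : 0 ≤ s) : s ≤ logRate a fun _ => c * streamPower (Fintype.card n) d s := by
  have hE : 0 ≤ Real.exp (s / Fintype.card n) - 1 :=
    sub_nonneg.2 (Real.one_le_exp (by positivity))
  calc s = ∑ _ : n, s / Fintype.card n := by
        rw [Finset.sum_const, Finset.card_univ, nsmul_eq_mul, mul_div_cancel₀ s (by positivity)]
    _ ≤ _ := Finset.sum_le_sum fun q _ => ?_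
  rw [Real.le_log_iff_exp_le]
  · have hρ : 1 ≤ c * a q / d := (one_le_div hd).2 (h.le_gain q)
    calc Real.exp (s / Fintype.card n) = 1 + (Real.exp (s / Fintype.card n) - 1) * 1 := by ring
      _ ≤ 1 + (Real.exp (s / Fintype.card n) - 1) * (c * a q / d) := by gcongr
      _ = _ := by rw [streamPower]; ring
  · have hc := zero_le_one.trans h.one_le
    exact zero_lt_one.trans_le (one_le_one_add_mul
      (mul_nonneg hc (streamPower_nonneg _ hd.le hs)) (h.pos hd q).le)

theorem WithinFactor.abs_logRate_streamPower_sub_le [Nonempty n] (h : WithinFactor c a d)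
    (hd : 0 < d) (hs : 0 ≤ s) :
    |logRate a (fun _ => streamPower (Fintype.card n) d s) - s| ≤
      Fintype.card n * Real.log c := by
  have hn : 0 < Fintype.card n := Fintype.card_pos
  have hp := streamPower_nonneg (Fintype.card n) hd.le hs
  rw [abs_sub_le_iff]
  constructor
  · have hpower := h.card_mul_streamPower_le hd (fun _ => hp) le_rfl
    rw [Finset.sum_const, Finset.card_univ, nsmul_eq_mul, mul_left_comm] at hpower
    have hle := (le_of_mul_le_mul_left hpower (Nat.cast_pos.2 hn)).trans
      (mul_streamPower_le hn hd h.one_le)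
    linarith [(strictMono_streamPower hn hd).le_iff_le.1 hle]
  · rcases le_total s (Fintype.card n * Real.log c) with hsc | hsc
    · linarith [logRate_nonneg (fun q => (h.pos hd q).le) fun _ => hp]
    · have hs' := sub_nonneg.2 hsc
      have hle := mul_streamPower_le (s := s - Fintype.card n * Real.log c) hn hd h.one_le
      rw [sub_add_cancel] at hle
      have hc := zero_le_one.trans h.one_le
      linarith [h.le_logRate_mul_streamPower hd hs', logRate_le_logRate (fun q => (h.pos hd q).le)
        (fun _ => mul_nonneg hc (streamPower_nonneg (Fintype.card n) hd.le hs')) fun _ => hle]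

end SingleUser

section ManyUsers

variable {ι : Type*} {κ : ι → Type*} [∀ i, Fintype (κ i)] {a P : ∀ i, κ i → ℝ}
  {d : ι → ℝ} {B c s : ℝ}

/-- The smallest rate of all users under the allocation `P`. -/
noncomputable def minLogRate (a P : ∀ i, κ i → ℝ) : ℝ := ⨅ i, logRate (a i) (P i)

theorem minLogRate_le [Finite ι] (a P : ∀ i, κ i → ℝ) (i : ι) :
    minLogRate a P ≤ logRate (a i) (P i) :=
  ciInf_le (Set.finite_range _).bddBelow i

theorem lt_minLogRate [Finite ι] [Nonempty ι] (h : ∀ i, s < logRate (a i) (P i)) :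
    s < minLogRate a P := by
  obtain ⟨i, hi⟩ := exists_eq_ciInf_of_finite (f := fun i => logRate (a i) (P i))
  exact (h i).trans_eq hi

variable [Fintype ι]

/-- The power with which every user `i` attains the rate `s`, all of its channels having
gain `d i`. -/
noncomputable def powerCost (κ : ι → Type*) [∀ i, Fintype (κ i)] (d : ι → ℝ) (s : ℝ) : ℝ :=
  ∑ i, Fintype.card (κ i) * streamPower (Fintype.card (κ i)) (d i) s

theorem powerCost_zero : powerCost κ d 0 = 0 := by simp [powerCost, streamPower_zero]

theorem div_le_powerCost [∀ i, Nonempty (κ i)] (hd : ∀ i, 0 < d i) (hs : 0 ≤ s) (i : ι) :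
    s / d i ≤ powerCost κ d s :=
  (div_le_mul_streamPower Fintype.card_pos (hd i)).trans <|
    Finset.single_le_sum
      (f := fun i => Fintype.card (κ i) * streamPower (Fintype.card (κ i)) (d i) s)
      (fun i _ => mul_nonneg (Nat.cast_nonneg _) (streamPower_nonneg _ (hd i).le hs))
      (Finset.mem_univ i)

theorem strictMono_powerCost [Nonempty ι] [∀ i, Nonempty (κ i)] (hd : ∀ i, 0 < d i) :
    StrictMono (powerCost κ d) := fun _ _ hst =>
  Finset.sum_lt_sum_of_nonempty Finset.univ_nonempty fun i _ =>
    mul_lt_mul_of_pos_left (strictMono_streamPower Fintype.card_pos (hd i) hst)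
      (Nat.cast_pos.2 Fintype.card_pos)

theorem continuous_powerCost : Continuous (powerCost κ d) := by
  unfold powerCost streamPower
  fun_prop

theorem existsUnique_powerCost_eq [Nonempty ι] [∀ i, Nonempty (κ i)] (hd : ∀ i, 0 < d i)
    (hB : 0 ≤ B) : ∃! s, powerCost κ d s = B := by
  obtain ⟨i⟩ := ‹Nonempty ι›
  have : Nonempty ι := ⟨i⟩
  have hs : 0 ≤ B * d i := mul_nonneg hB (hd i).le
  have hle : B ≤ powerCost κ d (B * d i) := by
    simpa only [mul_div_cancel_right₀ B (hd i).ne'] using div_le_powerCost (κ := κ) hd hs i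
  obtain ⟨s, -, hsB⟩ := intermediate_value_Icc hs continuous_powerCost.continuousOn
    ⟨powerCost_zero.trans_le hB, hle⟩
  exact ⟨s, hsB, fun t ht => (strictMono_powerCost hd).injective (ht.trans hsB.symm)⟩

theorem pos_of_powerCost_pos [Nonempty ι] [∀ i, Nonempty (κ i)] (hd : ∀ i, 0 < d i)
    (h : 0 < powerCost κ d s) : 0 < s :=
  (strictMono_powerCost hd).lt_iff_lt.1 (powerCost_zero.trans_lt h)

theorem mul_powerCost_le [∀ i, Nonempty (κ i)] (hd : ∀ i, 0 < d i) (hc : 1 ≤ c) :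
    c * powerCost κ d s ≤
      powerCost κ d (s + (∑ i, (Fintype.card (κ i) : ℝ)) * Real.log c) := by
  rw [powerCost, Finset.mul_sum]
  refine Finset.sum_le_sum fun i _ => ?_
  rw [mul_left_comm]
  gcongr
  refine (mul_streamPower_le Fintype.card_pos (hd i) hc).trans
    ((strictMono_streamPower Fintype.card_pos (hd i)).monotone ?_)
  gcongr
  · exact Real.log_nonneg hc
  · exact Finset.single_le_sum (f := fun i => (Fintype.card (κ i) : ℝ))
      (fun _ _ => Nat.cast_nonneg _) (Finset.mem_univ i)

/-- The allocations of nonnegative powers to all streams of all users within the budget `B`. -/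
def powerBudget (κ : ι → Type*) [∀ i, Fintype (κ i)] (B : ℝ) : Set (∀ i, κ i → ℝ) :=
  {P | (∀ i q, 0 ≤ P i q) ∧ ∑ i, ∑ q, P i q ≤ B}

/-- The allocation that splits the power of each user evenly so that, if all channels of user `i`
had gain `d i`, every user would attain the rate `s`. -/
noncomputable def equalPower (κ : ι → Type*) [∀ i, Fintype (κ i)] (d : ι → ℝ) (s : ℝ) :
    ∀ i, κ i → ℝ :=
  fun i _ => streamPower (Fintype.card (κ i)) (d i) s

theorem sum_equalPower : ∑ i, ∑ q, equalPower κ d s i q = powerCost κ d s := by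
  simp only [equalPower, powerCost, Finset.sum_const, Finset.card_univ, nsmul_eq_mul]

theorem equalPower_mem_powerBudget (hd : ∀ i, 0 ≤ d i) (hs : 0 ≤ s)
    (h : powerCost κ d s ≤ B) : equalPower κ d s ∈ powerBudget κ B :=
  ⟨fun i _ => streamPower_nonneg _ (hd i) hs, sum_equalPower.trans_le h⟩

theorem isCompact_powerBudget : IsCompact (powerBudget κ B) := by
  refine isCompact_Icc.of_isClosed_subset (s := Set.Icc 0 fun _ _ => B) ?_ fun P hP => ?_
  · have hnonneg : IsClosed {P : ∀ i, κ i → ℝ | ∀ i q, 0 ≤ P i q} := by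
      simp only [Set.ofPred_forall]
      exact isClosed_iInter fun i => isClosed_iInter fun q =>
        isClosed_le continuous_const (by fun_prop)
    exact hnonneg.inter (isClosed_le (f := fun P : ∀ i, κ i → ℝ => ∑ i, ∑ q, P i q)
      (by fun_prop) continuous_const)
  · refine ⟨fun i q => hP.1 i q, fun i q => le_trans ?_ hP.2⟩
    exact (Finset.single_le_sum (fun q _ => hP.1 i q) (Finset.mem_univ q)).trans <|
      Finset.single_le_sum (f := fun i => ∑ q, P i q)
        (fun i _ => Finset.sum_nonneg fun q _ => hP.1 i q) (Finset.mem_univ i)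

/-- `P` solves the max-min fairness problem for gains `a` and power budget `B`. -/
def IsMaxMin (B : ℝ) (a P : ∀ i, κ i → ℝ) : Prop :=
  P ∈ powerBudget κ B ∧ IsMaxOn (minLogRate a) (powerBudget κ B) P

theorem continuousOn_minLogRate [Nonempty ι] (ha : ∀ i q, 0 ≤ a i q) :
    ContinuousOn (minLogRate a) (powerBudget κ B) := by
  have hmin : minLogRate a = fun P => Finset.univ.inf' Finset.univ_nonempty
      fun i => logRate (a i) (P i) :=
    funext fun P => (Finset.inf'_univ_eq_ciInf _).symm
  rw [hmin]
  refine ContinuousOn.finset_inf'_apply _ fun i _ => continuousOn_finsetSum _ fun q _ =>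
    ContinuousOn.log (Continuous.continuousOn (by fun_prop)) fun P hP => ?_
  exact (zero_lt_one.trans_le (one_le_one_add_mul (hP.1 i q) (ha i q))).ne'

theorem exists_isMaxMin [Nonempty ι] (ha : ∀ i q, 0 ≤ a i q) (hB : 0 ≤ B) :
    ∃ P, IsMaxMin B a P :=
  isCompact_powerBudget.exists_isMaxOn ⟨0, by simp [powerBudget, hB]⟩ (continuousOn_minLogRate ha)

/-- Power saved on one user, spread over all streams, would raise every rate. -/
theorem IsMaxMin.sum_le_of_minLogRate_le [∀ i, Nonempty (κ i)]
    (hP : IsMaxMin B a P) (ha : ∀ i q, 0 < a i q) {i : ι} {p : κ i → ℝ} (hp : ∀ q, 0 ≤ p q)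
    (h : minLogRate a P ≤ logRate (a i) p) : ∑ q, P i q ≤ ∑ q, p q := by
  classical
  by_contra! hlt
  have : Nonempty ι := ⟨i⟩
  set P' := Function.update P i p with hP'
  have hnonneg : ∀ j q, 0 ≤ P' j q := fun j => by
    obtain rfl | hj := eq_or_ne j i
    · simpa only [hP', Function.update_self] using hp
    · simpa only [hP', Function.update_of_ne hj] using hP.1.1 j
  have hrate : ∀ j, minLogRate a P ≤ logRate (a j) (P' j) := fun j => by
    obtain rfl | hj := eq_or_ne j i
    · simpa only [hP', Function.update_self] using h
    · simpa only [hP', Function.update_of_ne hj] using minLogRate_le a P j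
  have hsave : ∑ j, ∑ q, P' j q < ∑ j, ∑ q, P j q := by
    refine Finset.sum_lt_sum (fun j _ => ?_) ⟨i, Finset.mem_univ i, ?_⟩
    · obtain rfl | hj := eq_or_ne j i
      · simpa only [hP', Function.update_self] using hlt.le
      · simp only [hP', Function.update_of_ne hj, le_refl]
    · simpa only [hP', Function.update_self] using hlt
  set n : ℝ := ∑ j, (Fintype.card (κ j) : ℝ) with hn
  have hn0 : 0 < n := Finset.sum_pos (fun j _ => Nat.cast_pos.2 Fintype.card_pos)
    Finset.univ_nonempty
  set δ := (∑ j, ∑ q, P j q - ∑ j, ∑ q, P' j q) / n with hδ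
  have hδ0 : 0 < δ := div_pos (sub_pos.2 hsave) hn0
  have htotal : ∑ j, ∑ q, (P' j q + δ) = ∑ j, ∑ q, P j q := by
    simp only [Finset.sum_add_distrib, Finset.sum_const, Finset.card_univ, nsmul_eq_mul,
      ← Finset.sum_mul, ← hn, hδ]
    rw [mul_div_cancel₀ _ hn0.ne', add_sub_cancel]
  have hmem : (fun j q => P' j q + δ) ∈ powerBudget κ B :=
    ⟨fun j q => add_nonneg (hnonneg j q) hδ0.le, htotal.trans_le hP.1.2⟩
  exact (hP.2 hmem).not_gt <| lt_minLogRate fun j =>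
    (hrate j).trans_lt (logRate_lt_logRate_add_const (ha j) (hnonneg j) hδ0)

/-- Optimality keeps the user from spending more than `c` times the equal power, so the arithmetic
mean of its factors `1 + SINR` exceeds their geometric mean by at most the factor `c ^ 2`. -/
theorem IsMaxMin.sub_one_sub_log_le [∀ i, Nonempty (κ i)] (hP : IsMaxMin B a P)
    (hac : ∀ i, WithinFactor c (a i) (d i)) (hd : ∀ i, 0 < d i) (i : ι) (q : κ i) {y : ℝ}
    (hy : y = (1 + P i q * a i q) / Real.exp (minLogRate a P / Fintype.card (κ i))) :
    y - 1 - Real.log y ≤ Fintype.card (κ i) * (c ^ 2 - 1) := by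
  have ha : ∀ i q, 0 < a i q := fun i => (hac i).pos (hd i)
  have hc := (hac i).one_le
  have hmin : 0 ≤ minLogRate a P :=
    Real.iInf_nonneg fun i => logRate_nonneg (fun q => (ha i q).le) (hP.1.1 i)
  set E := Real.exp (minLogRate a P / Fintype.card (κ i)) with hE
  have hpower : ∑ q, P i q ≤
      Fintype.card (κ i) * (c * streamPower (Fintype.card (κ i)) (d i) (minLogRate a P)) := by
    have hle := hP.sum_le_of_minLogRate_le ha
      (fun _ => mul_nonneg (zero_le_one.trans hc) (streamPower_nonneg _ (hd i).le hmin))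
      ((hac i).le_logRate_mul_streamPower (hd i) hmin)
    simpa only [Finset.sum_const, Finset.card_univ, nsmul_eq_mul] using hle
  have hsum : ∑ q, (1 + P i q * a i q) ≤ c ^ 2 * Fintype.card (κ i) * E :=
    calc ∑ q, (1 + P i q * a i q)
        ≤ Fintype.card (κ i) + c * d i * ∑ q, P i q := (hac i).sum_one_add_le (hP.1.1 i)
      _ ≤ Fintype.card (κ i) + c * d i * (Fintype.card (κ i) *
            (c * streamPower (Fintype.card (κ i)) (d i) (minLogRate a P))) := by
          have := hd i
          gcongr
      _ = Fintype.card (κ i) + c ^ 2 * Fintype.card (κ i) * (E - 1) := by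
          rw [streamPower, ← hE]
          field_simp [(hd i).ne']
      _ ≤ c ^ 2 * Fintype.card (κ i) * E := by
          have := mul_le_mul_of_nonneg_right (one_le_pow₀ hc : 1 ≤ c ^ 2)
            (Nat.cast_nonneg (α := ℝ) (Fintype.card (κ i)))
          linarith
  have hdeficit := sub_one_sub_log_le_of_le_sum_log
    (fun q => zero_lt_one.trans_le (one_le_one_add_mul (hP.1.1 i q) (ha i q).le))
    (minLogRate_le a P i) q
  rw [← div_le_iff₀ (Real.exp_pos _)] at hsum
  rw [hy]
  linarith

/-- The bound is a rate for which equal powers would cost at least `c` times the budget. -/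
theorem minLogRate_le_of_mem_powerBudget [Nonempty ι] [∀ i, Nonempty (κ i)]
    (hac : ∀ i, WithinFactor c (a i) (d i)) (hd : ∀ i, 0 < d i)
    (hs : powerCost κ d s = B) (hP : P ∈ powerBudget κ B) :
    minLogRate a P ≤ s + (∑ i, (Fintype.card (κ i) : ℝ)) * Real.log c := by
  have hc := (hac (Classical.arbitrary ι)).one_le
  rw [← (strictMono_powerCost (κ := κ) hd).le_iff_le]
  calc powerCost κ d (minLogRate a P) ≤ ∑ i, c * ∑ q, P i q := Finset.sum_le_sum fun i _ =>
        (hac i).card_mul_streamPower_le (hd i) (hP.1 i) (minLogRate_le a P i)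
    _ = c * ∑ i, ∑ q, P i q := by rw [Finset.mul_sum]
    _ ≤ c * powerCost κ d s := by
        rw [hs]
        exact mul_le_mul_of_nonneg_left hP.2 (zero_le_one.trans hc)
    _ ≤ _ := mul_powerCost_le hd hc

theorem abs_logRate_equalPower_sub_le [∀ i, Nonempty (κ i)]
    (hac : ∀ i, WithinFactor c (a i) (d i)) (hd : ∀ i, 0 < d i) (hs : 0 ≤ s) (i : ι) :
    |logRate (a i) (equalPower κ d s i) - s| ≤
      (∑ i, (Fintype.card (κ i) : ℝ)) * Real.log c := by
  refine ((hac i).abs_logRate_streamPower_sub_le (hd i) hs).trans ?_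
  gcongr
  · exact Real.log_nonneg (hac i).one_le
  · exact Finset.single_le_sum (f := fun i => (Fintype.card (κ i) : ℝ))
      (fun _ _ => Nat.cast_nonneg _) (Finset.mem_univ i)

end ManyUsers

section Asymptotics

variable {X : Type*} {l : Filter X}

/-- Since `y - 1 - log y` dominates `(√y - 1) ^ 2`, its smallness forces `y` to be close to `1`. -/
theorem tendsto_one_of_sub_one_sub_log_le {y δ : X → ℝ} (hy : ∀ᶠ x in l, 0 < y x)
    (h : ∀ᶠ x in l, y x - 1 - Real.log (y x) ≤ δ x) (hδ : Tendsto δ l (𝓝 0)) :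
    Tendsto y l (𝓝 1) := by
  have hsq : Tendsto (fun x => (√(y x) - 1) ^ 2) l (𝓝 0) := by
    refine squeeze_zero' (Eventually.of_forall fun x => sq_nonneg _) ?_ hδ
    filter_upwards [hy, h] with x hx hxδ
    have hlog := Real.log_le_sub_one_of_pos (Real.sqrt_pos.2 hx)
    rw [Real.log_sqrt hx.le] at hlog
    nlinarith [Real.sq_sqrt hx.le]
  have habs : Tendsto (fun x => |√(y x) - 1|) l (𝓝 0) := by
    simpa only [Real.sqrt_sq_eq_abs, Real.sqrt_zero] using hsq.sqrt
  have hsqrt : Tendsto (fun x => √(y x)) l (𝓝 1) :=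
    tendsto_sub_nhds_zero_iff.1 ((tendsto_zero_iff_abs_tendsto_zero _).2 habs)
  rw [← one_pow 2]
  exact (hsqrt.pow 2).congr' (hy.mono fun x hx => Real.sq_sqrt hx.le)

variable {ι : Type*} {κ : ι → Type*} {a P : X → ∀ i, κ i → ℝ} {d : X → ι → ℝ} {B : ℝ} {s : X → ℝ}

/-- The gains `a x` of the streams of each user `i` are asymptotically equal to a common gain
`d x i`, which tends to infinity. -/
structure HasAsymptoticGain (l : Filter X) (a : X → ∀ i, κ i → ℝ) (d : X → ι → ℝ) : Prop where
  tendsto_atTop : ∀ i, Tendsto (fun x => d x i) l atTop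
  tendsto_div : ∀ i q, Tendsto (fun x => a x i q / d x i) l (𝓝 1)

theorem HasAsymptoticGain.eventually_pos [Finite ι] (h : HasAsymptoticGain l a d) :
    ∀ᶠ x in l, ∀ i, 0 < d x i :=
  eventually_all.2 fun i => (h.tendsto_atTop i).eventually_gt_atTop 0

theorem HasAsymptoticGain.exists_withinFactor [Finite ι] [∀ i, Finite (κ i)]
    (h : HasAsymptoticGain l a d) :
    ∃ c : X → ℝ, Tendsto c l (𝓝 1) ∧ ∀ᶠ x in l, ∀ i, WithinFactor (c x) (a x i) (d x i) := by
  have := Fintype.ofFinite ι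
  have := fun i => Fintype.ofFinite (κ i)
  set e : X → ∀ i, κ i → ℝ := fun x i q => |a x i q / d x i - 1| + |(a x i q / d x i)⁻¹ - 1|
    with he
  have he0 : ∀ x i q, 0 ≤ e x i q := fun x i q => by positivity
  have hle : ∀ x i q, e x i q ≤ ∑ i, ∑ q, e x i q := fun x i q =>
    (Finset.single_le_sum (fun q _ => he0 x i q) (Finset.mem_univ q)).trans <|
      Finset.single_le_sum (f := fun i => ∑ q, e x i q)
        (fun i _ => Finset.sum_nonneg fun q _ => he0 x i q) (Finset.mem_univ i)
  refine ⟨fun x => 1 + ∑ i, ∑ q, e x i q, ?_, ?_⟩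
  · have hsum := tendsto_finsetSum Finset.univ fun i _ => tendsto_finsetSum Finset.univ
      fun (q : κ i) _ => ((h.tendsto_div i q).sub_const 1).abs.add
        (((h.tendsto_div i q).inv₀ one_ne_zero).sub_const 1).abs
    simpa only [he, sub_self, inv_one, abs_zero, add_zero, Finset.sum_const_zero] using
      hsum.const_add 1
  · have hratio : ∀ᶠ x in l, ∀ i q, 0 < a x i q / d x i :=
      eventually_all.2 fun i => eventually_all.2 fun q =>
        (h.tendsto_div i q).eventually_const_lt zero_lt_one
    filter_upwards [h.eventually_pos, hratio] with x hd hr i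
    refine ⟨?_, fun q => ?_, fun q => ?_⟩
    · exact le_add_of_nonneg_right
        (Finset.sum_nonneg fun i _ => Finset.sum_nonneg fun q _ => he0 x i q)
    · rw [← div_le_iff₀ (hd i)]
      linarith [hle x i q, le_abs_self (a x i q / d x i - 1),
        abs_nonneg ((a x i q / d x i)⁻¹ - 1)]
    · rw [← div_le_iff₀ ((div_pos_iff_of_pos_right (hd i)).1 (hr i q)), ← inv_div]
      linarith [hle x i q, le_abs_self ((a x i q / d x i)⁻¹ - 1),
        abs_nonneg (a x i q / d x i - 1)]

variable [Fintype ι] [∀ i, Fintype (κ i)]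

theorem tendsto_atTop_of_powerCost_eq [Nonempty ι] [∀ i, Nonempty (κ i)]
    (hd : ∀ i, Tendsto (fun x => d x i) l atTop) (hB : 0 < B)
    (hs : ∀ᶠ x in l, powerCost κ (d x) (s x) = B) : Tendsto s l atTop := by
  refine tendsto_atTop.2 fun b => ?_
  have hb : Tendsto (fun x => powerCost κ (d x) b) l (𝓝 0) := by
    simpa only [powerCost, streamPower, mul_zero, Finset.sum_const_zero] using
      tendsto_finsetSum Finset.univ fun i _ => ((hd i).const_div_atTop
        (Real.exp (b / Fintype.card (κ i)) - 1)).const_mul (Fintype.card (κ i) : ℝ)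
  filter_upwards [hs, hb.eventually_lt_const hB,
    eventually_all.2 fun i => (hd i).eventually_gt_atTop 0] with x hsx hbx hdx
  exact ((strictMono_powerCost hdx).lt_iff_lt.1 (hbx.trans_eq hsx.symm)).le

namespace HasAsymptoticGain

theorem eventually_exists_isMaxMin [Nonempty ι] (h : HasAsymptoticGain l a d) (hB : 0 ≤ B) :
    ∀ᶠ x in l, ∃ P, IsMaxMin B (a x) P := by
  obtain ⟨c, -, hc⟩ := h.exists_withinFactor
  filter_upwards [hc, h.eventually_pos] with x hac hd
  exact exists_isMaxMin (fun i q => ((hac i).pos (hd i) q).le) hB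

theorem eventually_equalPower_mem_powerBudget [Nonempty ι] [∀ i, Nonempty (κ i)]
    (h : HasAsymptoticGain l a d) (hB : 0 < B) (hs : ∀ᶠ x in l, powerCost κ (d x) (s x) = B) :
    ∀ᶠ x in l, equalPower κ (d x) (s x) ∈ powerBudget κ B := by
  filter_upwards [h.eventually_pos, hs] with x hd hsx
  exact equalPower_mem_powerBudget (fun i => (hd i).le)
    (pos_of_powerCost_pos hd (hB.trans_eq hsx.symm)).le hsx.le

theorem exists_error [Nonempty ι] [∀ i, Nonempty (κ i)] (h : HasAsymptoticGain l a d)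
    (hB : 0 < B) (hs : ∀ᶠ x in l, powerCost κ (d x) (s x) = B) :
    ∃ ε : X → ℝ, Tendsto ε l (𝓝 0) ∧ ∀ᶠ x in l,
      (∀ i, |logRate (a x i) (equalPower κ (d x) (s x) i) - s x| ≤ ε x) ∧
      ∀ P ∈ powerBudget κ B, minLogRate (a x) P ≤ s x + ε x := by
  obtain ⟨c, hc1, hc⟩ := h.exists_withinFactor
  refine ⟨fun x => (∑ i, (Fintype.card (κ i) : ℝ)) * Real.log (c x), ?_, ?_⟩
  · simpa using (hc1.log one_ne_zero).const_mul (∑ i, (Fintype.card (κ i) : ℝ))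
  · filter_upwards [hc, h.eventually_pos, hs] with x hac hd hsx
    exact ⟨abs_logRate_equalPower_sub_le hac hd
      (pos_of_powerCost_pos hd (hB.trans_eq hsx.symm)).le,
      fun P hP => minLogRate_le_of_mem_powerBudget hac hd hsx hP⟩

theorem tendsto_logRate_equalPower_sub [Nonempty ι] [∀ i, Nonempty (κ i)]
    (h : HasAsymptoticGain l a d) (hB : 0 < B) (hs : ∀ᶠ x in l, powerCost κ (d x) (s x) = B)
    (i : ι) :
    Tendsto (fun x => logRate (a x i) (equalPower κ (d x) (s x) i) - s x) l (𝓝 0) := by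
  obtain ⟨ε, hε0, hε⟩ := h.exists_error hB hs
  exact squeeze_zero_norm' (hε.mono fun x hx => hx.1 i) hε0

theorem tendsto_minLogRate_sub_of_le [Nonempty ι] [∀ i, Nonempty (κ i)]
    (h : HasAsymptoticGain l a d) (hB : 0 < B) (hs : ∀ᶠ x in l, powerCost κ (d x) (s x) = B)
    (hP : ∀ᶠ x in l, P x ∈ powerBudget κ B ∧
      minLogRate (a x) (equalPower κ (d x) (s x)) ≤ minLogRate (a x) (P x)) :
    Tendsto (fun x => minLogRate (a x) (P x) - s x) l (𝓝 0) := by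
  obtain ⟨ε, hε0, hε⟩ := h.exists_error hB hs
  refine squeeze_zero_norm' ?_ hε0
  filter_upwards [hε, hP] with x ⟨hequal, hopt⟩ ⟨hmem, hle⟩
  have hlower : s x - ε x ≤ minLogRate (a x) (equalPower κ (d x) (s x)) :=
    le_ciInf fun i => by linarith [(abs_le.1 (hequal i)).1]
  rw [Real.norm_eq_abs, abs_le]
  constructor <;> linarith [hopt (P x) hmem]

theorem tendsto_minLogRate_sub [Nonempty ι] [∀ i, Nonempty (κ i)]
    (h : HasAsymptoticGain l a d) (hB : 0 < B) (hs : ∀ᶠ x in l, powerCost κ (d x) (s x) = B)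
    (hP : ∀ᶠ x in l, IsMaxMin B (a x) (P x)) :
    Tendsto (fun x => minLogRate (a x) (P x) - s x) l (𝓝 0) := by
  refine h.tendsto_minLogRate_sub_of_le hB hs ?_
  filter_upwards [hP, h.eventually_equalPower_mem_powerBudget hB hs] with x hPx hmem
  exact ⟨hPx.1, hPx.2 hmem⟩

theorem tendsto_minLogRate_sub_minLogRate_equalPower [Nonempty ι] [∀ i, Nonempty (κ i)]
    (h : HasAsymptoticGain l a d) (hB : 0 < B) (hs : ∀ᶠ x in l, powerCost κ (d x) (s x) = B)
    (hP : ∀ᶠ x in l, IsMaxMin B (a x) (P x)) :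
    Tendsto (fun x => minLogRate (a x) (P x) - minLogRate (a x) (equalPower κ (d x) (s x)))
      l (𝓝 0) := by
  have hequal := h.tendsto_minLogRate_sub_of_le hB hs
    ((h.eventually_equalPower_mem_powerBudget hB hs).mono fun x hx => ⟨hx, le_rfl⟩)
  simpa only [sub_sub_sub_cancel_right, sub_zero] using
    (h.tendsto_minLogRate_sub hB hs hP).sub hequal

theorem tendsto_one_add_div_exp_minLogRate [∀ i, Nonempty (κ i)] (h : HasAsymptoticGain l a d)
    (hP : ∀ᶠ x in l, IsMaxMin B (a x) (P x)) (i : ι) (q : κ i) :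
    Tendsto (fun x => (1 + P x i q * a x i q) /
      Real.exp (minLogRate (a x) (P x) / Fintype.card (κ i))) l (𝓝 1) := by
  obtain ⟨c, hc1, hc⟩ := h.exists_withinFactor
  refine tendsto_one_of_sub_one_sub_log_le
    (δ := fun x => Fintype.card (κ i) * (c x ^ 2 - 1)) ?_ ?_ ?_
  · filter_upwards [hc, h.eventually_pos, hP] with x hac hd hPx
    exact div_pos (zero_lt_one.trans_le
      (one_le_one_add_mul (hPx.1.1 i q) ((hac i).pos (hd i) q).le)) (Real.exp_pos _)
  · filter_upwards [hc, h.eventually_pos, hP] with x hac hd hPx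
    exact hPx.sub_one_sub_log_le hac hd i q rfl
  · simpa using ((hc1.pow 2).sub_const 1).const_mul (Fintype.card (κ i) : ℝ)

theorem tendsto_one_add_div_exp [Nonempty ι] [∀ i, Nonempty (κ i)] (h : HasAsymptoticGain l a d)
    (hB : 0 < B) (hs : ∀ᶠ x in l, powerCost κ (d x) (s x) = B)
    (hP : ∀ᶠ x in l, IsMaxMin B (a x) (P x)) (i : ι) (q : κ i) :
    Tendsto (fun x => (1 + P x i q * a x i q) / Real.exp (s x / Fintype.card (κ i))) l (𝓝 1) := by
  have hexp := (Real.continuous_exp.tendsto _).comp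
    ((h.tendsto_minLogRate_sub hB hs hP).div_const (Fintype.card (κ i)))
  rw [zero_div, Real.exp_zero] at hexp
  have hmul := (h.tendsto_one_add_div_exp_minLogRate hP i q).mul hexp
  rw [mul_one] at hmul
  refine hmul.congr fun x => ?_
  rw [Function.comp_apply, sub_div, Real.exp_sub, div_mul_div_cancel₀ (Real.exp_pos _).ne']

theorem tendsto_logRate_sub [Nonempty ι] [∀ i, Nonempty (κ i)] (h : HasAsymptoticGain l a d)
    (hB : 0 < B) (hs : ∀ᶠ x in l, powerCost κ (d x) (s x) = B)
    (hP : ∀ᶠ x in l, IsMaxMin B (a x) (P x)) (i : ι) :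
    Tendsto (fun x => logRate (a x i) (P x i) - s x) l (𝓝 0) := by
  have hlog := tendsto_finsetSum Finset.univ fun q _ =>
    (h.tendsto_one_add_div_exp hB hs hP i q).log one_ne_zero
  rw [Real.log_one, Finset.sum_const_zero] at hlog
  obtain ⟨c, -, hc⟩ := h.exists_withinFactor
  refine hlog.congr' ?_
  filter_upwards [hc, h.eventually_pos, hP] with x hac hd hPx
  have hne : ∀ q, 1 + P x i q * a x i q ≠ 0 := fun q =>
    (zero_lt_one.trans_le (one_le_one_add_mul (hPx.1.1 i q) ((hac i).pos (hd i) q).le)).ne'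
  simp only [Real.log_div (hne _) (Real.exp_pos _).ne', Real.log_exp, Finset.sum_sub_distrib,
    Finset.sum_const, Finset.card_univ, nsmul_eq_mul, logRate]
  rw [mul_div_cancel₀ _ (by positivity)]

theorem isEquivalent_equalPower [Nonempty ι] [∀ i, Nonempty (κ i)] (h : HasAsymptoticGain l a d)
    (hB : 0 < B) (hs : ∀ᶠ x in l, powerCost κ (d x) (s x) = B)
    (hP : ∀ᶠ x in l, IsMaxMin B (a x) (P x)) (i : ι) (q : κ i) :
    Asymptotics.IsEquivalent l (fun x => P x i q) fun x => equalPower κ (d x) (s x) i q := by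
  set E : X → ℝ := fun x => Real.exp (s x / Fintype.card (κ i))
  have hEtop : Tendsto E l atTop := Real.tendsto_exp_atTop.comp
    ((tendsto_atTop_of_powerCost_eq h.tendsto_atTop hB hs).atTop_div_const (by positivity))
  have hone : (fun _ => (1 : ℝ)) =o[l] E :=
    (Asymptotics.isLittleO_const_left_of_ne one_ne_zero).2 (tendsto_norm_atTop_atTop.comp hEtop)
  have hsinr : Asymptotics.IsEquivalent l (fun x => P x i q * a x i q) fun x => E x - 1 := by
    have hfactor : Asymptotics.IsEquivalent l (fun x => 1 + P x i q * a x i q) E :=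
      Asymptotics.isEquivalent_of_tendsto_one (h.tendsto_one_add_div_exp hB hs hP i q)
    have hsub := (hfactor.sub_isLittleO hone).trans
      ((Asymptotics.IsEquivalent.refl.sub_isLittleO hone).symm)
    exact hsub.congr_left (Eventually.of_forall fun x => add_sub_cancel_left _ _)
  have hgain : Asymptotics.IsEquivalent l (fun x => a x i q) fun x => d x i :=
    Asymptotics.isEquivalent_of_tendsto_one (h.tendsto_div i q)
  refine (hsinr.div hgain).congr_left ?_
  obtain ⟨c, -, hc⟩ := h.exists_withinFactor
  filter_upwards [hc, h.eventually_pos] with x hac hd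
  exact mul_div_cancel_right₀ _ ((hac i).pos (hd i) q).ne'

end HasAsymptoticGain

end Asymptotics

/-! ### Asymptotics of the rates and powers -/

section Translation

variable {Ψ : Type*} {Q : ℕ} {M : Ψ → Fin Q → ℕ} {β : Ψ → Fin Q → ℝ} {N₀ Ptot Θ T R : ℝ} {L : ℕ}
  {h : Channel L M} {m : Directions L M} {P : Powers M}

/-- The type of the streams of user `u`, which is the type of parallel channels of this user in the
max-min fairness problem. -/
abbrev Streams (M : Ψ → Fin Q → ℕ) (u : Ψ × Fin Q) : Type := Fin (M u.1 u.2)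

/-- The power allocation `P`, with the users indexed by pairs. -/
def perUser (P : Powers M) (u : Ψ × Fin Q) : Streams M u → ℝ := P u.1 u.2

/-- The noise-normalized gains with which the streams of user `u` arrive. -/
noncomputable def streamGain (N₀ : ℝ) (h : Channel L M) (m : Directions L M) (u : Ψ × Fin Q) :
    Streams M u → ℝ :=
  fun q => gain h m u.1 u.2 q u.2 q / N₀

/-- The noise-normalized deterministic approximation of the gains of the streams of user `u`. -/
noncomputable def detGain (N₀ : ℝ) (M : Ψ → Fin Q → ℕ) (β : Ψ → Fin Q → ℝ) (L : ℕ)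
    (u : Ψ × Fin Q) : ℝ :=
  detEig M β L u.1 u.2 / N₀

/-- The design leaves no interference within the groups, so that the streams form parallel
channels. -/
def IsInterferenceFree (N₀ : ℝ) (h : Channel L M) (m : Directions L M) : Prop :=
  ∀ (P : Powers M) (u : Ψ × Fin Q) (q : Streams M u),
    sinr N₀ h m P u.1 u.2 q = perUser P u q * streamGain N₀ h m u q

theorem detGain_pos (hN₀ : 0 < N₀) (hβ : ∀ ψ k, 0 < β ψ k)
    (hL : ∀ ψ k, groupAntennas M ψ < L + M ψ k) (u : Ψ × Fin Q) : 0 < detGain N₀ M β L u :=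
  div_pos (detEig_pos (hβ u.1 u.2) (hL u.1 u.2)) hN₀

theorem IsDesign.isInterferenceFree (hm : IsDesign h m)
    (hu : ∀ ψ k, IsUnit (othersGram h ψ k).det) : IsInterferenceFree N₀ h m :=
  fun P u q => hm.sinr_eq hu N₀ P u.1 u.2 q

theorem detEig_of_forall_eq {M₀ : ℕ} (hM₀ : ∀ ψ k, M ψ k = M₀) (ψ : Ψ) (k : Fin Q) :
    detEig M β L ψ k = β ψ k * (L - ((Q : ℝ) - 1) * M₀) := by
  simp only [detEig, groupAntennas, hM₀, Finset.sum_const, Finset.card_univ, Fintype.card_fin,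
    smul_eq_mul]
  push_cast
  ring

variable [Fintype Ψ]

theorem numUsers_pos [Nonempty Ψ] [NeZero Q] : 0 < numUsers Ψ Q :=
  mul_pos (Nat.cast_pos.2 Fintype.card_pos) (Nat.cast_pos.2 (NeZero.pos Q))

/-- The rate `R / (G Q)` per user, without the loss due to pilot transmission. -/
noncomputable def rawRate (M : Ψ → Fin Q → ℕ) (Θ T R : ℝ) : ℝ :=
  R / (csiFactor M Θ T * numUsers Ψ Q)

theorem rawRate_div (M : Ψ → Fin Q → ℕ) (Θ T R : ℝ) (n : ℕ) :
    R / (csiFactor M Θ T * n * numUsers Ψ Q) = rawRate M Θ T R / n := by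
  rw [rawRate, div_div, mul_right_comm]

theorem csiFactor_mul_rawRate (hξ : csiFactor M Θ T ≠ 0) :
    csiFactor M Θ T * rawRate M Θ T R = R / numUsers Ψ Q := by
  rw [rawRate, ← mul_div_assoc, mul_div_mul_left _ _ hξ]

theorem perUser_detPower :
    perUser (detPower Θ T N₀ M β L R) =
      equalPower (Streams M) (detGain N₀ M β L) (rawRate M Θ T R) := by
  funext u q
  rw [perUser, detPower, equalPower, streamPower, detGain, rawRate_div, Fintype.card_fin,
    div_div_eq_mul_div, mul_comm N₀]

theorem totalPower_eq_sum_perUser : totalPower P = ∑ u, ∑ q, perUser P u q :=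
  (Fintype.sum_prod_type fun u => ∑ q, perUser P u q).symm

theorem totalPower_detPower :
    totalPower (detPower Θ T N₀ M β L R) =
      powerCost (Streams M) (detGain N₀ M β L) (rawRate M Θ T R) := by
  rw [totalPower_eq_sum_perUser, perUser_detPower, sum_equalPower]

theorem solvesExpEq_iff_totalPower_detPower :
    SolvesExpEq Θ T N₀ Ptot M β L R ↔ totalPower (detPower Θ T N₀ M β L R) = Ptot := by
  simp only [SolvesExpEq, totalPower, detPower, Finset.sum_const, Finset.card_univ,
    Fintype.card_fin, nsmul_eq_mul, mul_div_assoc, mul_left_comm, mul_assoc]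

theorem solvesExpEq_iff_powerCost_eq :
    SolvesExpEq Θ T N₀ Ptot M β L R ↔
      powerCost (Streams M) (detGain N₀ M β L) (rawRate M Θ T R) = Ptot := by
  rw [solvesExpEq_iff_totalPower_detPower, totalPower_detPower]

theorem feasible_iff_perUser_mem_powerBudget :
    Feasible Ptot P ↔ perUser P ∈ powerBudget (Streams M) Ptot := by
  rw [Feasible, totalPower_eq_sum_perUser]
  exact and_congr_left' (Prod.forall (p := fun u => ∀ q, 0 ≤ perUser P u q)).symm

theorem existsUnique_solvesExpEq [Nonempty Ψ] [NeZero Q] [∀ ψ k, NeZero (M ψ k)]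
    (hβ : ∀ ψ k, 0 < β ψ k) (hN₀ : 0 < N₀) (hPtot : 0 ≤ Ptot) (hξ : csiFactor M Θ T ≠ 0)
    (hL : ∀ ψ k, groupAntennas M ψ < L + M ψ k) : ∃! R, SolvesExpEq Θ T N₀ Ptot M β L R := by
  have hξn : csiFactor M Θ T * numUsers Ψ Q ≠ 0 := mul_ne_zero hξ numUsers_pos.ne'
  obtain ⟨s, hs, hunique⟩ :=
    existsUnique_powerCost_eq (κ := Streams M) (detGain_pos hN₀ hβ hL) hPtot
  refine ⟨s * (csiFactor M Θ T * numUsers Ψ Q), solvesExpEq_iff_powerCost_eq.2 ?_, fun R hR => ?_⟩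
  · rwa [rawRate, mul_div_cancel_right₀ _ hξn]
  · rw [← hunique _ (solvesExpEq_iff_powerCost_eq.1 hR), rawRate, div_mul_cancel₀ _ hξn]

theorem solvesExpEq_closedForm [Nonempty Ψ] [NeZero Q] (hβ : ∀ ψ k, 0 < β ψ k) (hN₀ : 0 < N₀)
    (hPtot : 0 ≤ Ptot) (hξ : csiFactor M Θ T ≠ 0) (hL : ∀ ψ k, groupAntennas M ψ < L + M ψ k)
    {M₀ : ℕ} (hM₀pos : 0 < M₀) (hM₀ : ∀ ψ k, M ψ k = M₀) :
    SolvesExpEq Θ T N₀ Ptot M β L (closedForm Θ T N₀ Ptot M β M₀ L) := by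
  have hsum : 0 < ∑ ψ, ∑ k, (β ψ k)⁻¹ :=
    Finset.sum_pos (fun ψ _ => Finset.sum_pos (fun k _ => inv_pos.2 (hβ ψ k)) Finset.univ_nonempty)
      Finset.univ_nonempty
  set Λ := (L : ℝ) - ((Q : ℝ) - 1) * M₀ with hΛ
  set S := ∑ ψ, ∑ k, (β ψ k)⁻¹
  have hΛpos : 0 < Λ := by
    have hpos := detEig_pos (hβ (Classical.arbitrary Ψ) 0) (hL _ _)
    rw [detEig_of_forall_eq hM₀] at hpos
    exact (mul_pos_iff_of_pos_left (hβ _ _)).1 hpos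
  have hexp : Real.exp (closedForm Θ T N₀ Ptot M β M₀ L /
      (csiFactor M Θ T * M₀ * numUsers Ψ Q)) = 1 + Ptot * Λ / (N₀ * M₀ * S) := by
    have hn := (numUsers_pos (Ψ := Ψ) (Q := Q)).ne'
    rw [closedForm, mul_right_comm (csiFactor M Θ T), mul_div_cancel_left₀ _ (by positivity),
      Real.exp_log (by positivity)]
  have hterm : ∀ ψ k, N₀ * (M ψ k : ℝ) *
      (Real.exp (closedForm Θ T N₀ Ptot M β M₀ L /
        (csiFactor M Θ T * (M ψ k : ℝ) * numUsers Ψ Q)) - 1) / detEig M β L ψ k =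
      Ptot / S * (β ψ k)⁻¹ := fun ψ k => by
    have hβψk := (hβ ψ k).ne'
    rw [hM₀ ψ k, hexp, detEig_of_forall_eq hM₀, ← hΛ, add_sub_cancel_left]
    field_simp
  simp only [SolvesExpEq, hterm, ← Finset.mul_sum]
  exact div_mul_cancel₀ _ hsum.ne'

theorem IsInterferenceFree.rate_eq (hm : IsInterferenceFree N₀ h m) (P : Powers M)
    (u : Ψ × Fin Q) :
    rate Θ T N₀ h m P u.1 u.2 =
      csiFactor M Θ T * logRate (streamGain N₀ h m u) (perUser P u) := by
  simp only [rate, logRate, hm P u]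

theorem IsInterferenceFree.minRate_eq (hm : IsInterferenceFree N₀ h m)
    (hξ : 0 ≤ csiFactor M Θ T) (P : Powers M) :
    minRate Θ T N₀ h m P = csiFactor M Θ T * minLogRate (streamGain N₀ h m) (perUser P) := by
  simp only [minRate, minLogRate, hm.rate_eq, Real.mul_iInf_of_nonneg hξ]

theorem IsInterferenceFree.isMMFOptimal_iff (hm : IsInterferenceFree N₀ h m)
    (hξ : 0 < csiFactor M Θ T) :
    IsMMFOptimal Θ T N₀ Ptot h m P ↔ IsMaxMin Ptot (streamGain N₀ h m) (perUser P) := by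
  simp only [IsMMFOptimal, IsMaxMin, isMaxOn_iff, feasible_iff_perUser_mem_powerBudget,
    hm.minRate_eq hξ.le, mul_le_mul_iff_right₀ hξ]
  exact and_congr_right' ⟨fun hP P' => hP fun ψ k => P' (ψ, k), fun hP P' => hP (perUser P')⟩

end Translation

section Limits

variable {Ψ : Type*} {Q : ℕ} {M : Ψ → Fin Q → ℕ} {β : Ψ → Fin Q → ℝ} {N₀ Ptot Θ T : ℝ}
  {h : ∀ L : ℕ, Channel L M} {m : ∀ L : ℕ, Directions L M} {R : ℕ → ℝ} {P : ℕ → Powers M}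

/-- In the limit of many transmit antennas the streams of the designs `m` become interference-free
channels whose gains are approximated by the deterministic ones. -/
structure HasDetLimit (N₀ : ℝ) (β : Ψ → Fin Q → ℝ) (h : ∀ L : ℕ, Channel L M)
    (m : ∀ L : ℕ, Directions L M) : Prop where
  eventually_isInterferenceFree : ∀ᶠ L in atTop, IsInterferenceFree N₀ (h L) (m L)
  hasAsymptoticGain : HasAsymptoticGain atTop (fun L => streamGain N₀ (h L) (m L))
    (detGain N₀ M β)

theorem FavorablePropagation.hasDetLimit [Finite Ψ] (hh : FavorablePropagation β h)
    (hβ : ∀ ψ k, 0 < β ψ k) (hN₀ : 0 < N₀) (hm : ∀ᶠ L in atTop, IsDesign (h L) (m L)) :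
    HasDetLimit N₀ β h m where
  eventually_isInterferenceFree := by
    filter_upwards [hm, hh.eventually_isUnit_det_othersGram_all fun ψ k => (hβ ψ k).ne']
      with L hmL hu
    exact hmL.isInterferenceFree hu
  hasAsymptoticGain :=
    { tendsto_atTop := fun u => (tendsto_detEig_atTop (hβ u.1 u.2)).atTop_div_const hN₀
      tendsto_div := fun u q => by
        simpa only [streamGain, detGain, div_div_div_cancel_right₀ hN₀.ne'] using
          hh.tendsto_gain_div_detEig (fun k => (hβ u.1 k).ne') hm u.2 q }

variable [Fintype Ψ]

theorem HasDetLimit.eventually_isMaxMin (hg : HasDetLimit N₀ β h m) (hξ : 0 < csiFactor M Θ T)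
    (hP : ∀ᶠ L in atTop, IsMMFOptimal Θ T N₀ Ptot (h L) (m L) (P L)) :
    ∀ᶠ L in atTop, IsMaxMin Ptot (streamGain N₀ (h L) (m L)) (perUser (P L)) := by
  filter_upwards [hg.eventually_isInterferenceFree, hP] with L hm hPL
  exact (hm.isMMFOptimal_iff hξ).1 hPL

variable [Nonempty Ψ] [NeZero Q]

theorem eventually_eq_closedForm [∀ ψ k, NeZero (M ψ k)] (hβ : ∀ ψ k, 0 < β ψ k) (hN₀ : 0 < N₀)
    (hPtot : 0 ≤ Ptot) (hξ : csiFactor M Θ T ≠ 0)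
    (hR : ∀ᶠ L in atTop, SolvesExpEq Θ T N₀ Ptot M β L (R L)) {M₀ : ℕ}
    (hM₀ : ∀ ψ k, M ψ k = M₀) : R =ᶠ[atTop] closedForm Θ T N₀ Ptot M β M₀ := by
  have hM₀pos : 0 < M₀ := hM₀ (Classical.arbitrary Ψ) 0 ▸ NeZero.pos _
  have hlarge : ∀ᶠ L in atTop, ∀ ψ k, groupAntennas M ψ < L + M ψ k :=
    eventually_all.2 fun ψ => eventually_all.2 fun k =>
      (eventually_gt_atTop (groupAntennas M ψ)).mono fun L hL => hL.trans_le (Nat.le_add_right _ _)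
  filter_upwards [hR, hlarge] with L hRL hL
  exact (existsUnique_solvesExpEq hβ hN₀ hPtot hξ hL).unique hRL
    (solvesExpEq_closedForm hβ hN₀ hPtot hξ hL hM₀pos hM₀)

namespace HasDetLimit

theorem eventually_exists_isMMFOptimal (hg : HasDetLimit N₀ β h m) (hPtot : 0 ≤ Ptot)
    (hξ : 0 < csiFactor M Θ T) :
    ∀ᶠ L in atTop, ∃ P, IsMMFOptimal Θ T N₀ Ptot (h L) (m L) P := by
  filter_upwards [hg.eventually_isInterferenceFree,
    hg.hasAsymptoticGain.eventually_exists_isMaxMin hPtot] with L hm ⟨P, hP⟩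
  exact ⟨fun ψ k => P (ψ, k), (hm.isMMFOptimal_iff hξ).2 hP⟩

variable [∀ ψ k, NeZero (M ψ k)]

theorem eventually_feasible_detPower (hg : HasDetLimit N₀ β h m) (hPtot : 0 < Ptot)
    (hR : ∀ᶠ L in atTop, SolvesExpEq Θ T N₀ Ptot M β L (R L)) :
    ∀ᶠ L in atTop, Feasible Ptot (detPower Θ T N₀ M β L (R L)) := by
  refine (hg.hasAsymptoticGain.eventually_equalPower_mem_powerBudget hPtot
    (hR.mono fun L => solvesExpEq_iff_powerCost_eq.1)).mono fun L hL => ?_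
  rwa [feasible_iff_perUser_mem_powerBudget, perUser_detPower]

theorem tendsto_rate_detPower_sub (hg : HasDetLimit N₀ β h m) (hPtot : 0 < Ptot)
    (hξ : csiFactor M Θ T ≠ 0) (hR : ∀ᶠ L in atTop, SolvesExpEq Θ T N₀ Ptot M β L (R L))
    (u : Ψ × Fin Q) :
    Tendsto (fun L => rate Θ T N₀ (h L) (m L) (detPower Θ T N₀ M β L (R L)) u.1 u.2 -
      R L / numUsers Ψ Q) atTop (𝓝 0) := by
  have hlim := (hg.hasAsymptoticGain.tendsto_logRate_equalPower_sub hPtot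
    (hR.mono fun L => solvesExpEq_iff_powerCost_eq.1) u).const_mul (csiFactor M Θ T)
  rw [mul_zero] at hlim
  refine hlim.congr' (hg.eventually_isInterferenceFree.mono fun L hm => ?_)
  simp only [mul_sub, csiFactor_mul_rawRate hξ, hm.rate_eq, perUser_detPower]

theorem tendsto_rate_sub (hg : HasDetLimit N₀ β h m) (hPtot : 0 < Ptot)
    (hξ : 0 < csiFactor M Θ T) (hR : ∀ᶠ L in atTop, SolvesExpEq Θ T N₀ Ptot M β L (R L))
    (hP : ∀ᶠ L in atTop, IsMMFOptimal Θ T N₀ Ptot (h L) (m L) (P L)) (u : Ψ × Fin Q) :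
    Tendsto (fun L => rate Θ T N₀ (h L) (m L) (P L) u.1 u.2 - R L / numUsers Ψ Q)
      atTop (𝓝 0) := by
  have hlim := (hg.hasAsymptoticGain.tendsto_logRate_sub hPtot
    (hR.mono fun L => solvesExpEq_iff_powerCost_eq.1) (hg.eventually_isMaxMin hξ hP) u).const_mul
      (csiFactor M Θ T)
  rw [mul_zero] at hlim
  refine hlim.congr' (hg.eventually_isInterferenceFree.mono fun L hm => ?_)
  simp only [mul_sub, csiFactor_mul_rawRate hξ.ne', hm.rate_eq]

theorem tendsto_sumRate_sub (hg : HasDetLimit N₀ β h m) (hPtot : 0 < Ptot)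
    (hξ : 0 < csiFactor M Θ T) (hR : ∀ᶠ L in atTop, SolvesExpEq Θ T N₀ Ptot M β L (R L))
    (hP : ∀ᶠ L in atTop, IsMMFOptimal Θ T N₀ Ptot (h L) (m L) (P L)) :
    Tendsto (fun L => sumRate Θ T N₀ (h L) (m L) (P L) - R L) atTop (𝓝 0) := by
  have hsum : ∀ L, ∑ u : Ψ × Fin Q, (rate Θ T N₀ (h L) (m L) (P L) u.1 u.2 - R L / numUsers Ψ Q) =
      sumRate Θ T N₀ (h L) (m L) (P L) - R L := fun L => by
    rw [Finset.sum_sub_distrib, Fintype.sum_prod_type, Finset.sum_const, Finset.card_univ,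
      Fintype.card_prod, Fintype.card_fin, nsmul_eq_mul, Nat.cast_mul, ← numUsers,
      mul_div_cancel₀ _ numUsers_pos.ne', sumRate]
  simpa only [Finset.sum_const_zero, hsum] using
    tendsto_finsetSum Finset.univ fun u _ => hg.tendsto_rate_sub hPtot hξ hR hP u

theorem isEquivalent_sumRate (hg : HasDetLimit N₀ β h m) (hPtot : 0 < Ptot)
    (hξ : 0 < csiFactor M Θ T) (hR : ∀ᶠ L in atTop, SolvesExpEq Θ T N₀ Ptot M β L (R L))
    (hP : ∀ᶠ L in atTop, IsMMFOptimal Θ T N₀ Ptot (h L) (m L) (P L)) :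
    Asymptotics.IsEquivalent atTop (fun L => sumRate Θ T N₀ (h L) (m L) (P L)) R := by
  have hraw : Tendsto (fun L => rawRate M Θ T (R L)) atTop atTop :=
    tendsto_atTop_of_powerCost_eq hg.hasAsymptoticGain.tendsto_atTop hPtot
      (hR.mono fun L => solvesExpEq_iff_powerCost_eq.1)
  have hRtop : Tendsto R atTop atTop :=
    (tendsto_div_const_atTop_of_pos (mul_pos hξ numUsers_pos)).1 hraw
  have hone : (fun _ => (1 : ℝ)) =o[atTop] R :=
    (Asymptotics.isLittleO_const_left_of_ne one_ne_zero).2 (tendsto_norm_atTop_atTop.comp hRtop)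
  exact ((Asymptotics.isLittleO_one_iff ℝ).2 (hg.tendsto_sumRate_sub hPtot hξ hR hP)).trans hone

theorem tendsto_minRate_sub_minRate_detPower (hg : HasDetLimit N₀ β h m) (hPtot : 0 < Ptot)
    (hξ : 0 < csiFactor M Θ T) (hR : ∀ᶠ L in atTop, SolvesExpEq Θ T N₀ Ptot M β L (R L))
    (hP : ∀ᶠ L in atTop, IsMMFOptimal Θ T N₀ Ptot (h L) (m L) (P L)) :
    Tendsto (fun L => minRate Θ T N₀ (h L) (m L) (P L) -
      minRate Θ T N₀ (h L) (m L) (detPower Θ T N₀ M β L (R L))) atTop (𝓝 0) := by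
  have hlim := (hg.hasAsymptoticGain.tendsto_minLogRate_sub_minLogRate_equalPower hPtot
    (hR.mono fun L => solvesExpEq_iff_powerCost_eq.1) (hg.eventually_isMaxMin hξ hP)).const_mul
      (csiFactor M Θ T)
  rw [mul_zero] at hlim
  refine hlim.congr' (hg.eventually_isInterferenceFree.mono fun L hm => ?_)
  simp only [mul_sub, hm.minRate_eq hξ.le, perUser_detPower]

theorem isEquivalent_detPower (hg : HasDetLimit N₀ β h m) (hPtot : 0 < Ptot)
    (hξ : 0 < csiFactor M Θ T) (hR : ∀ᶠ L in atTop, SolvesExpEq Θ T N₀ Ptot M β L (R L))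
    (hP : ∀ᶠ L in atTop, IsMMFOptimal Θ T N₀ Ptot (h L) (m L) (P L)) (u : Ψ × Fin Q)
    (q : Streams M u) :
    Asymptotics.IsEquivalent atTop (fun L => perUser (P L) u q)
      fun L => perUser (detPower Θ T N₀ M β L (R L)) u q := by
  simp only [perUser_detPower]
  exact hg.hasAsymptoticGain.isEquivalent_equalPower hPtot
    (hR.mono fun L => solvesExpEq_iff_powerCost_eq.1) (hg.eventually_isMaxMin hξ hP) u q

end HasDetLimit

end Limits

end VCC

theorem lemma2_general {Ψ : Type*} [Fintype Ψ] [Nonempty Ψ] {Q : ℕ} (hQ : 0 < Q)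
    (M : Ψ → Fin Q → ℕ) (hM : ∀ ψ k, 0 < M ψ k)
    (β : Ψ → Fin Q → ℝ) (hβ : ∀ ψ k, 0 < β ψ k)
    (N₀ Ptot Θ T : ℝ) (hN₀ : 0 < N₀) (hPtot : 0 < Ptot)
    (hξ : 0 < VCC.csiFactor M Θ T) :
    (∀ L : ℕ, (∀ ψ k, VCC.groupAntennas M ψ < L + M ψ k) →
      (∃! R : ℝ, VCC.SolvesExpEq Θ T N₀ Ptot M β L R) ∧
      ∀ M₀ : ℕ, (∀ ψ k, M ψ k = M₀) →
        VCC.SolvesExpEq Θ T N₀ Ptot M β L (VCC.closedForm Θ T N₀ Ptot M β M₀ L)) ∧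
    ∀ h : (∀ L : ℕ, VCC.Channel L M), VCC.FavorablePropagation β h →
      (∀ ψ k q, Tendsto (fun L : ℕ => VCC.eigval (h L) ψ k q / VCC.detEig M β L ψ k)
        atTop (𝓝 1)) ∧
      (∀ᶠ L : ℕ in atTop, (∀ ψ k, (VCC.effGram (h L) ψ k).rank = M ψ k) ∧
        ∃ m : VCC.Directions L M, VCC.IsDesign (h L) m) ∧
      ∀ m : (∀ L : ℕ, VCC.Directions L M), (∀ᶠ L : ℕ in atTop, VCC.IsDesign (h L) (m L)) →
      ∀ R : ℕ → ℝ, (∀ᶠ L : ℕ in atTop, VCC.SolvesExpEq Θ T N₀ Ptot M β L (R L)) →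
        (∀ᶠ L : ℕ in atTop, ∃ P : VCC.Powers M,
          VCC.IsMMFOptimal Θ T N₀ Ptot (h L) (m L) P) ∧
        (∀ᶠ L : ℕ in atTop, VCC.Feasible Ptot (VCC.detPower Θ T N₀ M β L (R L)) ∧
          VCC.totalPower (VCC.detPower Θ T N₀ M β L (R L)) = Ptot) ∧
        (∀ ψ k, Tendsto (fun L : ℕ =>
          VCC.rate Θ T N₀ (h L) (m L) (VCC.detPower Θ T N₀ M β L (R L)) ψ k
            - R L / VCC.numUsers Ψ Q) atTop (𝓝 0)) ∧
        ∀ P : ℕ → VCC.Powers M,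
          (∀ᶠ L : ℕ in atTop, VCC.IsMMFOptimal Θ T N₀ Ptot (h L) (m L) (P L)) →
          Tendsto (fun L : ℕ => VCC.sumRate Θ T N₀ (h L) (m L) (P L) - R L) atTop (𝓝 0) ∧
          Asymptotics.IsEquivalent atTop
            (fun L : ℕ => VCC.sumRate Θ T N₀ (h L) (m L) (P L)) R ∧
          Tendsto (fun L : ℕ => VCC.minRate Θ T N₀ (h L) (m L) (P L)
            - VCC.minRate Θ T N₀ (h L) (m L) (VCC.detPower Θ T N₀ M β L (R L)))
            atTop (𝓝 0) ∧
          (∀ ψ k q, Asymptotics.IsEquivalent atTop (fun L : ℕ => P L ψ k q)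
            (fun L : ℕ => VCC.detPower Θ T N₀ M β L (R L) ψ k q)) ∧
          (∀ M₀ : ℕ, (∀ ψ k, M ψ k = M₀) →
            Tendsto (fun L : ℕ => VCC.sumRate Θ T N₀ (h L) (m L) (P L)
              - VCC.closedForm Θ T N₀ Ptot M β M₀ L) atTop (𝓝 0) ∧
            Asymptotics.IsEquivalent atTop
              (fun L : ℕ => VCC.sumRate Θ T N₀ (h L) (m L) (P L))
              (fun L : ℕ => VCC.closedForm Θ T N₀ Ptot M β M₀ L)) := by
  have : NeZero Q := ⟨hQ.ne'⟩
  have : ∀ ψ k, NeZero (M ψ k) := fun ψ k => ⟨(hM ψ k).ne'⟩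
  have hβ0 : ∀ ψ k, β ψ k ≠ 0 := fun ψ k => (hβ ψ k).ne'
  refine ⟨fun L hL => ⟨VCC.existsUnique_solvesExpEq hβ hN₀ hPtot.le hξ.ne' hL, fun M₀ hM₀ =>
    VCC.solvesExpEq_closedForm hβ hN₀ hPtot.le hξ.ne' hL
      (hM₀ (Classical.arbitrary Ψ) 0 ▸ hM _ _) hM₀⟩, fun h hh => ?_⟩
  refine ⟨fun ψ => hh.tendsto_eigval_div_detEig (hβ0 ψ),
    hh.eventually_rank_effGram_and_exists_isDesign hβ0, fun m hm R hR => ?_⟩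
  have hg := hh.hasDetLimit hβ hN₀ hm
  refine ⟨hg.eventually_exists_isMMFOptimal hPtot.le hξ,
    (hg.eventually_feasible_detPower hPtot hR).and
      (hR.mono fun L => VCC.solvesExpEq_iff_totalPower_detPower.1),
    fun ψ k => hg.tendsto_rate_detPower_sub hPtot hξ.ne' hR (ψ, k), fun P hP => ?_⟩
  have hsum := hg.tendsto_sumRate_sub hPtot hξ hR hP
  have hequiv := hg.isEquivalent_sumRate hPtot hξ hR hP
  refine ⟨hsum, hequiv, hg.tendsto_minRate_sub_minRate_detPower hPtot hξ hR hP,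
    fun ψ k => hg.isEquivalent_detPower hPtot hξ hR hP (ψ, k), fun M₀ hM₀ => ?_⟩
  have hclosed := VCC.eventually_eq_closedForm hβ hN₀ hPtot.le hξ.ne' hR hM₀
  exact ⟨hsum.congr' (hclosed.mono fun L hL => by rw [hL]), hequiv.congr_right hclosed⟩

theorem lemma2 {Ψ : Type*} [Fintype Ψ] [Nonempty Ψ] {Q : ℕ} (hQ : 0 < Q)
    (M : Ψ → Fin Q → ℕ) (hM : ∀ ψ k, 0 < M ψ k)
    (β : Ψ → Fin Q → ℝ) (hβ : ∀ ψ k, 0 < β ψ k)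
    (N₀ Ptot Θ T : ℝ) (hN₀ : 0 < N₀) (hPtot : 0 < Ptot) (hΘ : 0 ≤ Θ) (hT : 0 < T)
    (hξ : 0 < VCC.csiFactor M Θ T)
    {Ω : Type*} [MeasurableSpace Ω] (μ : Measure Ω) [IsProbabilityMeasure μ]
    (H : ∀ L : ℕ, Ω → VCC.Channel L M)
    (hH : ∀ L : ℕ, VCC.IsRayleigh μ β (H L)) :
    -- the exponential-sum equation determines a unique `R`, explicit for equal antenna numbers
    (∀ L : ℕ, (∀ ψ k, VCC.groupAntennas M ψ < L + M ψ k) →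
      (∃! R : ℝ, VCC.SolvesExpEq Θ T N₀ Ptot M β L R) ∧
      ∀ M₀ : ℕ, (∀ ψ k, M ψ k = M₀) →
        VCC.SolvesExpEq Θ T N₀ Ptot M β L (VCC.closedForm Θ T N₀ Ptot M β M₀ L)) ∧
    ∀ᵐ ω ∂μ,
      -- the eigenvalues
      (∀ ψ k q, Tendsto (fun L : ℕ => VCC.eigval (H L ω) ψ k q / VCC.detEig M β L ψ k)
        atTop (𝓝 1)) ∧
      -- full rank, so that BD-MRC with `M ψ k` streams for every user exists
      (∀ᶠ L : ℕ in atTop, (∀ ψ k, (VCC.effGram (H L ω) ψ k).rank = M ψ k) ∧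
        ∃ m : VCC.Directions L M, VCC.IsDesign (H L ω) m) ∧
      ∀ m : (∀ L : ℕ, VCC.Directions L M), (∀ᶠ L : ℕ in atTop, VCC.IsDesign (H L ω) (m L)) →
      ∀ R : ℕ → ℝ, (∀ᶠ L : ℕ in atTop, VCC.SolvesExpEq Θ T N₀ Ptot M β L (R L)) →
        -- the max-min fairness problem has a solution
        (∀ᶠ L : ℕ in atTop, ∃ P : VCC.Powers M,
          VCC.IsMMFOptimal Θ T N₀ Ptot (H L ω) (m L) P) ∧
        -- the explicit allocation is feasible, uses the whole power budget
        (∀ᶠ L : ℕ in atTop, VCC.Feasible Ptot (VCC.detPower Θ T N₀ M β L (R L)) ∧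
          VCC.totalPower (VCC.detPower Θ T N₀ M β L (R L)) = Ptot) ∧
        -- and gives every user asymptotically the rate `R / (G Q)`
        (∀ ψ k, Tendsto (fun L : ℕ =>
          VCC.rate Θ T N₀ (H L ω) (m L) (VCC.detPower Θ T N₀ M β L (R L)) ψ k
            - R L / VCC.numUsers Ψ Q) atTop (𝓝 0)) ∧
        ∀ P : ℕ → VCC.Powers M,
          (∀ᶠ L : ℕ in atTop, VCC.IsMMFOptimal Θ T N₀ Ptot (H L ω) (m L) (P L)) →
          -- the optimal sum-rate is asymptotically `R`
          Tendsto (fun L : ℕ => VCC.sumRate Θ T N₀ (H L ω) (m L) (P L) - R L) atTop (𝓝 0) ∧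
          Asymptotics.IsEquivalent atTop
            (fun L : ℕ => VCC.sumRate Θ T N₀ (H L ω) (m L) (P L)) R ∧
          -- the explicit allocation is asymptotically optimal
          Tendsto (fun L : ℕ => VCC.minRate Θ T N₀ (H L ω) (m L) (P L)
            - VCC.minRate Θ T N₀ (H L ω) (m L) (VCC.detPower Θ T N₀ M β L (R L)))
            atTop (𝓝 0) ∧
          -- the optimal powers are asymptotically the explicit ones
          (∀ ψ k q, Asymptotics.IsEquivalent atTop (fun L : ℕ => P L ψ k q)
            (fun L : ℕ => VCC.detPower Θ T N₀ M β L (R L) ψ k q)) ∧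
          -- the closed form for equal antenna numbers
          (∀ M₀ : ℕ, (∀ ψ k, M ψ k = M₀) →
            Tendsto (fun L : ℕ => VCC.sumRate Θ T N₀ (H L ω) (m L) (P L)
              - VCC.closedForm Θ T N₀ Ptot M β M₀ L) atTop (𝓝 0) ∧
            Asymptotics.IsEquivalent atTop
              (fun L : ℕ => VCC.sumRate Θ T N₀ (H L ω) (m L) (P L))
              (fun L : ℕ => VCC.closedForm Θ T N₀ Ptot M β M₀ L)) := by
  obtain ⟨hR, hlim⟩ := lemma2_general hQ M hM β hβ N₀ Ptot Θ T hN₀ hPtot hξ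
  exact ⟨hR, (VCC.ae_favorablePropagation (fun ψ k => (hβ ψ k).le) hH).mono fun ω => hlim _⟩
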